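/- A \emph{Steiner triple system} of order $v$, STS$(v)$, is a pair $(V,\mathcal B)$ where $V$ is a set of $v$ points and $\mathcal B$ is a set of $3$-subsets of $V$ (blocks) such that any two distinct points lie in exactly one block. A \emph{Kirkman triple system} of order $v$, KTS$(v)$, is an STS$(v)$ together with a resolution $\mathcal R$ of $\mathcal B$, i.e. a partition of $\mathcal B$ into parallel classes, each of which is a partition of $V$. An \emph{automorphism} of a KTS is a permutation of its points leaving the resolution invariant. A KTS is \emph{$3$-pyramidal} if it admits a group of automorphisms that fixes three points and acts sharply transitively on the remaining points. Corollary. (a) For every natural number $v \equiv 39 \pmod{72}$ there exists a $3$-pyramidal KTS$(v)$. (b) For every integer $e \ge 0$ and every natural number $v \equiv 4^e\cdot 48 + 3 \pmod{4^e\cdot 96}$ there exists a $3$-pyramidal KTS$(v)$. In both cases the KTS$(v)$ has at least $v-3$ automorphisms. -/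

import Mathlib

open scoped Pointwise

/-- A Steiner triple system on the point set `V`: a set of 3-subsets of `V` (blocks) such that any
two distinct points lie together in exactly one block. -/
structure SteinerTripleSystem (V : Type*) where
  blocks : Set (Set V)
  ncard_block : ∀ B ∈ blocks, B.ncard = 3
  existsUnique_block : ∀ x y : V, x ≠ y → ∃! B, B ∈ blocks ∧ x ∈ B ∧ y ∈ B

/-- A Kirkman triple system on `V`: a Steiner triple system together with a resolution, that is,
a partition of the block set into (nonempty) parallel classes, each of which is a partition of
the point set. -/
structure KirkmanTripleSystem (V : Type*) extends SteinerTripleSystem V where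
  resolution : Set (Set (Set V))
  class_nonempty : ∀ P ∈ resolution, P.Nonempty
  class_subset : ∀ P ∈ resolution, P ⊆ blocks
  existsUnique_class : ∀ B ∈ blocks, ∃! P, P ∈ resolution ∧ B ∈ P
  class_isPartition : ∀ P ∈ resolution, Setoid.IsPartition P

namespace KirkmanTripleSystem

/-- The full automorphism group: the permutations `g` of the points leaving the resolution
invariant, i.e. `g • R = R` for the elementwise action of permutations on sets of sets of
blocks. -/
def autGroup {V : Type*} (K : KirkmanTripleSystem V) : Subgroup (Equiv.Perm V) :=
  MulAction.stabilizer (Equiv.Perm V) K.resolution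

/-- `K` is `f`-pyramidal: some group `G` of automorphisms fixes each of `f` points and acts
sharply transitively on the remaining points. -/
def IsPyramidal {V : Type*} (K : KirkmanTripleSystem V) (f : ℕ) : Prop :=
  ∃ G : Subgroup (Equiv.Perm V), G ≤ K.autGroup ∧
    ∃ F : Finset V, F.card = f ∧
      (∀ g ∈ G, ∀ x ∈ F, g x = x) ∧
      (∀ x y : V, x ∉ F → y ∉ F → ∃! g : Equiv.Perm V, g ∈ G ∧ g x = y)

end KirkmanTripleSystem

/-!
The systems of order `v = 3 |A| + 3` are built on a semidirect product `G = A ⋊ ℤ/3` and three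
fixed points, with `G` acting by left multiplication. The group `A` contains an involution `j` with
three conjugates. The blocks are the block of the fixed points, the left cosets of `0 ⋊ ℤ/3`, the
blocks `{c, p, p x}` where `c` is a fixed point and `x` a conjugate of `j`, and the translates of a
family of triples. Two points are in one block because the quotients `p⁻¹ q` of the triples cover
each remaining element of `G` once. The triples and their translates by `j` are disjoint and miss
only the points `(0, c)` and `(j, c)`; completed by three blocks through the fixed points they form
a parallel class, whose translates make up the resolution together with the class of the cosets.
Such a family of triples is a `Complete` cover, and `Complete.exists_kirkman` is this construction.

Complete covers come from three sources. Small ones, and the other finite families that are needed,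
are listed explicitly and checked by the kernel. Secondly, covers grow by covers relative to a
subgroup (`Complete.of_relCover`): for `A = (ℤ/2^m)²`, with `ℤ/3` acting through a matrix of order
three, the step from `2^m` to `2^(m+1)` is such a relative cover, and it is lifted from smaller `m`
along the reduction maps by difference matrices (`RelCover.lift`). Thirdly, `A` is multiplied by a
ring `W` of odd order with trivial action of `ℤ/3`. A relative cover multiplies by `W` as soon as
`W` has three units with invertible differences (`RelCover.prod`). A complete cover in addition
needs a cover of `A × W` relative to `A`; if `W` is a field with more than three elements, it comes
from a family over `A` whose triples are paired with triples of multipliers in `W`, which are fourth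
roots of unity (`FourthRootFamily.relProd`) or, up to squares, signs (`SignFamily.relProd`). Products of such fields have every odd order `w` except those divisible by
`3` and not by `9`; for the latter a factor `ℤ/3` is kept in the base group instead.
-/

/-! ### Semidirect products with `ℤ/3` and their difference covers -/

/-- An action of `ℤ/3` on the additive group `A` by group endomorphisms. It turns `A × ZMod 3` into
the semidirect product with multiplication `(a, c) (b, d) = (a + act c b, c + d)`. -/
structure Twist (A : Type) [AddCommGroup A] where
  act : ZMod 3 → A →+ A
  act_zero : ∀ a, act 0 a = a
  act_add : ∀ c d a, act (c + d) a = act c (act d a)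

/-- Ordered pairs of distinct positions in a block of size three. -/
abbrev Pairs : Type := {p : Fin 3 × Fin 3 // p.1 ≠ p.2}

namespace Twist

variable {A : Type} [AddCommGroup A] (T : Twist A)

lemma act_neg_act (c : ZMod 3) (a : A) : T.act (-c) (T.act c a) = a := by
  rw [← T.act_add, neg_add_cancel, T.act_zero]

lemma act_act_neg (c : ZMod 3) (a : A) : T.act c (T.act (-c) a) = a := by
  rw [← T.act_add, add_neg_cancel, T.act_zero]

lemma act_injective (c : ZMod 3) : Function.Injective (T.act c) :=
  Function.LeftInverse.injective (T.act_neg_act c)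

lemma act_eq_zero {c : ZMod 3} {a : A} : T.act c a = 0 ↔ a = 0 :=
  map_eq_zero_iff _ (T.act_injective c)

/-- The quotient `p⁻¹ q` in the semidirect product. -/
def diff (p q : A × ZMod 3) : A × ZMod 3 := (T.act (-p.2) (q.1 - p.1), q.2 - p.2)

/-- The product `g p` in the semidirect product. -/
def mul (g p : A × ZMod 3) : A × ZMod 3 := (g.1 + T.act g.2 p.1, g.2 + p.2)

/-- Left multiplication by `(j, 0)` if `ε` is true, and the identity otherwise. -/
def shift (j : A) (p : A × ZMod 3) (ε : Bool) : A × ZMod 3 := (p.1 + cond ε j 0, p.2)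

/-- The quotients `p⁻¹ q` of the ordered pairs of distinct positions in the blocks `B`. -/
def diffs {ι : Type} (B : ι → Fin 3 → A × ZMod 3) (x : ι × Pairs) : A × ZMod 3 :=
  T.diff (B x.1 x.2.1.1) (B x.1 x.2.1.2)

/-- The points of the blocks `B` and of their left translates by `(j, 0)`. -/
def points (j : A) {ι : Type} (B : ι → Fin 3 → A × ZMod 3) (x : ι × Fin 3 × Bool) : A × ZMod 3 :=
  shift j (B x.1 x.2.1) x.2.2

/-- A family of triples in the semidirect product whose quotients cover each element of `D`
exactly once and nothing else, and which together with its translate by `(j, 0)` partitions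
`S`. -/
structure IsCover (j : A) {ι : Type} (B : ι → Fin 3 → A × ZMod 3) (D S : Set (A × ZMod 3)) :
    Prop where
  diffs_injective : Function.Injective (T.diffs B)
  range_diffs : Set.range (T.diffs B) = D
  points_injective : Function.Injective (points j B)
  range_points : Set.range (points j B) = S

/-- Some family of triples covers the quotients `D` and the points `S`. -/
def HasCover (j : A) (D S : Set (A × ZMod 3)) : Prop :=
  ∃ (ι : Type) (B : ι → Fin 3 → A × ZMod 3), T.IsCover j B D S

/-- The covers from which Kirkman triple systems are built: the exceptional quotients are the
identity, the three conjugates of the involution `(j, 0)` and the elements `(0, ±1)`, and the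
exceptional points are the `(0, c)` and `(j, c)`. -/
def Complete (j : A) : Prop :=
  T.HasCover j {p | p.1 ≠ 0 ∧ ¬ (p.2 = 0 ∧ ∃ c, p.1 = T.act c j)} {p | p.1 ≠ 0 ∧ p.1 ≠ j}

/-- Covers relative to the subgroup `H ⋊ ℤ/3`. -/
def RelCover (j : A) (H : Set A) : Prop := T.HasCover j {p | p.1 ∉ H} {p | p.1 ∉ H}

variable {T}

lemma HasCover.union {j : A} {D S D' S' : Set (A × ZMod 3)} (h : T.HasCover j D S)
    (h' : T.HasCover j D' S') (hD : Disjoint D D') (hS : Disjoint S S') :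
    T.HasCover j (D ∪ D') (S ∪ S') := by
  obtain ⟨ι, B, hB⟩ := h
  obtain ⟨ι', B', hB'⟩ := h'
  refine ⟨ι ⊕ ι', Sum.elim B B', ?_, ?_, ?_, ?_⟩
  · rintro ⟨i | i, a⟩ ⟨k | k, b⟩ hab
    · have := hB.diffs_injective (a₁ := (i, a)) (a₂ := (k, b)) hab
      simpa using this
    · exact (hD.ne_of_mem (hB.range_diffs ▸ Set.mem_range_self (i, a))
        (hB'.range_diffs ▸ Set.mem_range_self (k, b)) hab).elim
    · exact (hD.ne_of_mem (hB.range_diffs ▸ Set.mem_range_self (k, b))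
        (hB'.range_diffs ▸ Set.mem_range_self (i, a)) hab.symm).elim
    · have := hB'.diffs_injective (a₁ := (i, a)) (a₂ := (k, b)) hab
      simpa using this
  · rw [← hB.range_diffs, ← hB'.range_diffs]
    ext d
    simp [diffs]
  · rintro ⟨i | i, a⟩ ⟨k | k, b⟩ hab
    · have := hB.points_injective (a₁ := (i, a)) (a₂ := (k, b)) hab
      simpa using this
    · exact (hS.ne_of_mem (hB.range_points ▸ Set.mem_range_self (i, a))
        (hB'.range_points ▸ Set.mem_range_self (k, b)) hab).elim
    · exact (hS.ne_of_mem (hB.range_points ▸ Set.mem_range_self (k, b))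
        (hB'.range_points ▸ Set.mem_range_self (i, a)) hab.symm).elim
    · have := hB'.points_injective (a₁ := (i, a)) (a₂ := (k, b)) hab
      simpa using this
  · rw [← hB.range_points, ← hB'.range_points]
    ext d
    simp [points]

/-- Covers are transported along equivariant embeddings. -/
lemma HasCover.map {A' : Type} [AddCommGroup A'] {T' : Twist A'} {j : A} {j' : A'} (φ : A →+ A')
    (hφ : Function.Injective φ) (hT : ∀ c a, φ (T.act c a) = T'.act c (φ a)) (hj : φ j = j')
    {D S : Set (A × ZMod 3)} (h : T.HasCover j D S) :
    T'.HasCover j' (Prod.map φ id '' D) (Prod.map φ id '' S) := by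
  obtain ⟨ι, B, hB⟩ := h
  have hinj : Function.Injective (Prod.map φ (id : ZMod 3 → ZMod 3)) :=
    hφ.prodMap Function.injective_id
  have hd : T'.diffs (fun i a => Prod.map φ id (B i a)) = Prod.map φ id ∘ T.diffs B := by
    ext x <;> simp [diffs, diff, hT]
  have hp : points j' (fun i a => Prod.map φ id (B i a)) = Prod.map φ id ∘ points j B := by
    ext ⟨i, a, ε⟩
    · cases ε <;> simp [points, shift, hj]
    · simp [points, shift]
  refine ⟨ι, fun i a => Prod.map φ id (B i a), ?_, ?_, ?_, ?_⟩
  · rw [hd]; exact hinj.comp hB.diffs_injective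
  · rw [hd, Set.range_comp, hB.range_diffs]
  · rw [hp]; exact hinj.comp hB.points_injective
  · rw [hp, Set.range_comp, hB.range_points]

/-- A complete cover of a subgroup and a cover relative to it make up a complete cover. -/
lemma Complete.of_relCover {A' : Type} [AddCommGroup A'] {T' : Twist A'} {j : A} {j' : A'}
    (h : T.Complete j) (φ : A →+ A') (hφ : Function.Injective φ)
    (hT : ∀ c a, φ (T.act c a) = T'.act c (φ a)) (hj : φ j = j')
    (h' : T'.RelCover j' (Set.range φ)) : T'.Complete j' := by
  have key := (HasCover.map φ hφ hT hj h).union h' ?_ ?_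
  · unfold Complete
    convert key using 1
    · ext ⟨a, c⟩
      by_cases ha : a ∈ Set.range φ
      · obtain ⟨a, rfl⟩ := ha
        have : ∀ d, φ a = T'.act d j' ↔ a = T.act d j := fun d => by
          rw [← hj, ← hT, hφ.eq_iff]
        simp [this, hφ.eq_iff, map_eq_zero_iff φ hφ]
      · have h0 : a ≠ 0 := fun h => ha ⟨0, by simp [h]⟩
        have hc : ∀ d, a ≠ T'.act d j' := fun d h => ha ⟨T.act d j, by rw [hT, hj, h]⟩
        exact iff_of_true ⟨h0, fun h => hc _ h.2.choose_spec⟩ (Or.inr ha)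
    · ext ⟨a, c⟩
      by_cases ha : a ∈ Set.range φ
      · obtain ⟨a, rfl⟩ := ha
        simp [← hj, hφ.eq_iff, map_eq_zero_iff φ hφ]
      · have h0 : a ≠ 0 := fun h => ha ⟨0, by simp [h]⟩
        have hc : a ≠ j' := fun h => ha ⟨j, by rw [hj, h]⟩
        exact iff_of_true ⟨h0, hc⟩ (Or.inr ha)
  all_goals
    rw [Set.disjoint_left]
    rintro _ ⟨⟨a, c⟩, -, rfl⟩ h2
    exact h2 ⟨a, rfl⟩

end Twist

/-! ### The Kirkman triple system of a complete cover -/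

namespace Twist

variable {A : Type} [AddCommGroup A] (T : Twist A)

/-- The point set: the semidirect product together with three fixed points. -/
abbrev Point (A : Type) : Type := (A × ZMod 3) ⊕ ZMod 3

lemma mul_assoc' (g h p : A × ZMod 3) : T.mul (T.mul g h) p = T.mul g (T.mul h p) := by
  simp [mul, T.act_add, add_assoc]

/-- The inverse in the semidirect product. -/
def inv (g : A × ZMod 3) : A × ZMod 3 := (-T.act (-g.2) g.1, -g.2)

lemma inv_mul_cancel_left (g p : A × ZMod 3) : T.mul (T.inv g) (T.mul g p) = p := by
  ext <;> simp [mul, inv, act_neg_act]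

lemma mul_inv_cancel_left (g p : A × ZMod 3) : T.mul g (T.mul (T.inv g) p) = p := by
  ext <;> simp [mul, inv, act_act_neg]

lemma mul_left_injective (g : A × ZMod 3) : Function.Injective (T.mul g) :=
  Function.LeftInverse.injective (T.inv_mul_cancel_left g)

lemma mul_diff (p q : A × ZMod 3) : T.mul p (T.diff p q) = q := by
  ext <;> simp [mul, diff, act_act_neg]

lemma diff_mul (p d : A × ZMod 3) : T.diff p (T.mul p d) = d := by
  ext <;> simp [mul, diff, act_neg_act]

lemma diff_mul_mul (g p q : A × ZMod 3) : T.diff (T.mul g p) (T.mul g q) = T.diff p q := by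
  conv_lhs => rw [← T.mul_diff p q, ← mul_assoc', diff_mul]

lemma mul_right_cancel' {g h p : A × ZMod 3} (e : T.mul g p = T.mul h p) : g = h := by
  have h2 : g.2 = h.2 := by simpa [mul] using congrArg Prod.snd e
  have h1 := congrArg Prod.fst e
  simp only [mul, h2] at h1
  exact Prod.ext (add_right_cancel h1) h2

/-- The unique `g` with `g p = q`. -/
lemma exists_mul_eq (p q : A × ZMod 3) : ∃ g, T.mul g p = q :=
  ⟨(q.1 - T.act (q.2 - p.2) p.1, q.2 - p.2), by ext <;> simp [mul]⟩

/-- Left multiplication on the semidirect product, extended by the identity to the three fixed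
points. -/
def perm (g : A × ZMod 3) : Equiv.Perm (Point A) where
  toFun := Sum.map (T.mul g) id
  invFun := Sum.map (T.mul (T.inv g)) id
  left_inv := by rintro (p | c) <;> simp [inv_mul_cancel_left]
  right_inv := by rintro (p | c) <;> simp [mul_inv_cancel_left]

@[simp] lemma perm_inl (g p : A × ZMod 3) : T.perm g (Sum.inl p) = Sum.inl (T.mul g p) := rfl
@[simp] lemma perm_inr (g : A × ZMod 3) (c : ZMod 3) : T.perm g (Sum.inr c) = Sum.inr c := rfl

lemma perm_mul (g h : A × ZMod 3) : T.perm (T.mul g h) = T.perm g * T.perm h := by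
  ext (p | c) <;> simp [mul_assoc']

lemma perm_zero : T.perm 0 = 1 := by
  ext (p | c) <;> simp [mul, T.act_zero]

/-- The left multiplications form a group of permutations. -/
def permGroup : Subgroup (Equiv.Perm (Point A)) where
  carrier := Set.range T.perm
  mul_mem' := by
    rintro _ _ ⟨g, rfl⟩ ⟨h, rfl⟩
    exact ⟨_, T.perm_mul g h⟩
  one_mem' := ⟨0, T.perm_zero⟩
  inv_mem' := by
    rintro _ ⟨g, rfl⟩
    refine ⟨T.inv g, ?_⟩
    ext (p | c) <;> rfl

variable (j : A) {ι : Type} (B : ι → Fin 3 → A × ZMod 3)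

/-- The block of the three fixed points. -/
def fixedBlock (A : Type) : Set (Point A) := Set.range Sum.inr

/-- The block through the fixed point `c` and the point `p`. Its third point is the product of `p`
by an involution on the right. -/
def axis (c : ZMod 3) (p : A × ZMod 3) : Set (Point A) :=
  {Sum.inr c, Sum.inl p, Sum.inl (p.1 + T.act (p.2 - c) j, p.2)}

/-- The left cosets of the subgroup of order three, as blocks. -/
def coset (a : A) : Set (Point A) := Set.range fun c : ZMod 3 => Sum.inl (a, c)

/-- The translates of the blocks of the family `B`. -/
def translate (g : A × ZMod 3) (t : ι) : Set (Point A) :=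
  Set.range fun i => Sum.inl (T.mul g (B t i))

/-- The blocks of the triple system. -/
def blockSet : Set (Set (Point A)) :=
  {b | b = fixedBlock A ∨ (∃ c p, b = T.axis j c p) ∨ (∃ a, b = coset a) ∨
    ∃ g t, b = T.translate B g t}

/-- The parallel class that is invariant under all left multiplications. -/
def fixedClass (A : Type) : Set (Set (Point A)) := insert (fixedBlock A) (Set.range coset)

/-- The translates by `g` of the parallel class that consists of the blocks `B`, their translates
by `(j, 0)`, and three blocks through the fixed points. -/
def parallelClass (g : A × ZMod 3) : Set (Set (Point A)) :=
  Set.range (fun c => T.axis j c (T.mul g (0, c))) ∪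
    (Set.range (T.translate B g) ∪ Set.range (T.translate B (T.mul g (j, 0))))

variable {T j B}

/-- The two sets of translates in a parallel class treated uniformly: right multiplication of `g` by
`(j, 0)` is left multiplication of `p` by it. -/
lemma mul_involution (g p : A × ZMod 3) (ε : Bool) :
    T.mul (cond ε (T.mul g (j, 0)) g) p = T.mul g (shift j p ε) := by
  cases ε
  · simp [shift]
  · ext
    · simp [mul, shift]
      abel
    · simp [mul, shift]

lemma axis_symm (hj : j + j = 0) (c : ZMod 3) (p : A × ZMod 3) :
    T.axis j c (p.1 + T.act (p.2 - c) j, p.2) = T.axis j c p := by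
  have : T.act (p.2 - c) j + T.act (p.2 - c) j = 0 := by rw [← map_add, hj, map_zero]
  simp [axis, add_assoc, this, Set.pair_comm]

lemma inl_mem_axis {c : ZMod 3} {p q : A × ZMod 3} : Sum.inl q ∈ T.axis j c p ↔
    q = p ∨ q = (p.1 + T.act (p.2 - c) j, p.2) := by
  simp [axis]

lemma axis_eq_of_mem (hj : j + j = 0) {c : ZMod 3} {p q : A × ZMod 3}
    (h : Sum.inl q ∈ T.axis j c p) : T.axis j c p = T.axis j c q := by
  rcases inl_mem_axis.1 h with rfl | rfl
  · rfl
  · exact (axis_symm hj c p).symm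

lemma mul_axis_point (g : A × ZMod 3) (c : ZMod 3) :
    T.axis j c (T.mul (T.mul g (j, 0)) (0, c)) =
      T.axis j c ((T.mul g (0, c)).1 + T.act ((T.mul g (0, c)).2 - c) j, (T.mul g (0, c)).2) := by
  simp [mul]

/-- Right multiplication of `g` by `(j, 0)` exchanges the two halves of the parallel class. -/
lemma parallelClass_mul (hj : j + j = 0) (g : A × ZMod 3) :
    T.parallelClass j B (T.mul g (j, 0)) = T.parallelClass j B g := by
  have h1 : T.mul (T.mul g (j, 0)) (j, 0) = g := by
    ext <;> simp [mul, add_assoc, ← map_add, hj]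
  unfold parallelClass
  rw [h1, Set.union_comm (Set.range (T.translate B g))]
  congr 1
  simp_rw [mul_axis_point, axis_symm hj]

lemma inl_mem_translate {g p : A × ZMod 3} {t : ι} :
    Sum.inl p ∈ T.translate B g t ↔ ∃ i, T.mul g (B t i) = p := by
  simp [translate]

lemma inl_mem_coset {A : Type} {a : A} {p : A × ZMod 3} : Sum.inl p ∈ coset a ↔ a = p.1 := by
  constructor
  · rintro ⟨c, hc⟩
    rw [← Sum.inl_injective hc]
  · rintro rfl
    exact ⟨p.2, rfl⟩

lemma act_ne_zero (hj0 : j ≠ 0) (c : ZMod 3) : T.act c j ≠ 0 := by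
  simpa [T.act_eq_zero] using hj0

/-- The three conjugates of the involution are distinct as soon as two of them are. -/
lemma act_involution_injective (hj1 : T.act 1 j ≠ j) :
    Function.Injective fun c => T.act c j := by
  intro c d h
  by_contra hcd
  have h' : T.act (c - d) j = j := by
    have := congrArg (T.act (-d)) h
    simp only [← T.act_add] at this
    rw [neg_add_cancel, T.act_zero] at this
    rwa [sub_eq_neg_add]
  have h0 : c - d ≠ 0 := sub_ne_zero.2 hcd
  have key : ∀ e : ZMod 3, e ≠ 0 → e = 1 ∨ e = 1 + 1 := by decide
  rcases key _ h0 with e | e <;> rw [e] at h'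
  · exact hj1 h'
  · apply hj1
    -- the action of `2 = -1` fixes `j`, hence so does that of `1`
    calc T.act 1 j = T.act 1 (T.act (1 + 1) j) := by rw [h']
      _ = T.act (1 + (1 + 1)) j := (T.act_add _ _ _).symm
      _ = j := by rw [show (1 + (1 + 1) : ZMod 3) = 0 by decide, T.act_zero]

end Twist

/-! ### The Steiner property -/

namespace Twist

variable {A : Type} [AddCommGroup A] {T : Twist A} {j : A} {ι : Type} {B : ι → Fin 3 → A × ZMod 3}

lemma ncard_range_fin_three {α β : Type} [Fintype α] (hα : Fintype.card α = 3) {f : α → β}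
    (hf : Function.Injective f) : (Set.range f).ncard = 3 := by
  rw [← Set.image_univ, Set.ncard_image_of_injective _ hf, Set.ncard_univ, Nat.card_eq_fintype_card,
    hα]

lemma diff_of_mem_coset {a : A} {p q : A × ZMod 3} (hp : Sum.inl p ∈ coset a)
    (hq : Sum.inl q ∈ coset a) : (T.diff p q).1 = 0 := by
  rw [inl_mem_coset] at hp hq
  simp [diff, ← hp, ← hq]

lemma diff_of_mem_axis (hj : j + j = 0) {c : ZMod 3} {r p q : A × ZMod 3}
    (hp : Sum.inl p ∈ T.axis j c r) (hq : Sum.inl q ∈ T.axis j c r) (hpq : p ≠ q) :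
    T.diff p q = (T.act (-c) j, 0) := by
  rw [axis_eq_of_mem hj hp, inl_mem_axis] at hq
  rcases hq with rfl | rfl
  · exact absurd rfl hpq
  · ext
    · simp only [diff, add_sub_cancel_left, ← T.act_add]
      congr 2
      ring
    · simp [diff]

namespace IsCover

variable {D S : Set (A × ZMod 3)} (hB : T.IsCover j B D S)
include hB

lemma eq_of_diff {t t' : ι} {a b a' b' : Fin 3} (hab : a ≠ b) (hab' : a' ≠ b')
    (h : T.diff (B t a) (B t b) = T.diff (B t' a') (B t' b')) : t = t' ∧ a = a' ∧ b = b' := by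
  have := hB.diffs_injective (a₁ := (t, ⟨(a, b), hab⟩)) (a₂ := (t', ⟨(a', b'), hab'⟩)) h
  simpa using this

lemma diff_mem (t : ι) {a b : Fin 3} (hab : a ≠ b) : T.diff (B t a) (B t b) ∈ D := by
  rw [← hB.range_diffs]
  exact ⟨(t, ⟨(a, b), hab⟩), rfl⟩

lemma point_injective (t : ι) : Function.Injective (B t) := fun a b h => by
  have := hB.points_injective (a₁ := (t, a, false)) (a₂ := (t, b, false)) (by simp [points, h])
  simpa using this

/-- A translate of a block of the family is determined by two of its points. -/
lemma translate_unique {g h p q : A × ZMod 3} {t u : ι} (hpq : p ≠ q)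
    (hp : Sum.inl p ∈ T.translate B g t) (hq : Sum.inl q ∈ T.translate B g t)
    (hp' : Sum.inl p ∈ T.translate B h u) (hq' : Sum.inl q ∈ T.translate B h u) :
    g = h ∧ t = u := by
  rw [inl_mem_translate] at hp hq hp' hq'
  obtain ⟨a, rfl⟩ := hp
  obtain ⟨b, rfl⟩ := hq
  obtain ⟨a', ha'⟩ := hp'
  obtain ⟨b', hb'⟩ := hq'
  have hab : a ≠ b := fun e => hpq (by rw [e])
  have hab' : a' ≠ b' := fun e => hpq (by rw [← ha', ← hb', e])
  have hd : T.diff (B u a') (B u b') = T.diff (B t a) (B t b) := by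
    rw [← T.diff_mul_mul h, ha', hb', diff_mul_mul]
  obtain ⟨rfl, rfl, rfl⟩ := hB.eq_of_diff hab' hab hd
  exact ⟨(T.mul_right_cancel' ha').symm, rfl⟩

lemma diff_mem_of_mem_translate {g p q : A × ZMod 3} {t : ι} (hpq : p ≠ q)
    (hp : Sum.inl p ∈ T.translate B g t) (hq : Sum.inl q ∈ T.translate B g t) :
    T.diff p q ∈ D := by
  rw [inl_mem_translate] at hp hq
  obtain ⟨a, rfl⟩ := hp
  obtain ⟨b, rfl⟩ := hq
  rw [diff_mul_mul]
  exact hB.diff_mem t fun e => hpq (by rw [e])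

lemma translate_injective {g h : A × ZMod 3} {t u : ι} (e : T.translate B g t = T.translate B h u) :
    g = h ∧ t = u := by
  have h0 : Sum.inl (T.mul g (B t 0)) ∈ T.translate B g t := ⟨0, rfl⟩
  have h1 : Sum.inl (T.mul g (B t 1)) ∈ T.translate B g t := ⟨1, rfl⟩
  refine hB.translate_unique ?_ h0 h1 (e ▸ h0) (e ▸ h1)
  intro h
  exact absurd (hB.point_injective t (T.mul_left_injective g h)) (by decide)

end IsCover

/-- The quotients that the family covers in a complete cover. -/
abbrev completeDiffs (T : Twist A) (j : A) : Set (A × ZMod 3) :=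
  {p | p.1 ≠ 0 ∧ ¬ (p.2 = 0 ∧ ∃ c, p.1 = T.act c j)}

/-- The points that the family covers in a complete cover. -/
abbrev completePoints (j : A) : Set (A × ZMod 3) := {p | p.1 ≠ 0 ∧ p.1 ≠ j}

lemma ncard_block (hj0 : j ≠ 0)
    (hB : T.IsCover j B (completeDiffs T j) (completePoints j)) :
    ∀ b ∈ T.blockSet j B, b.ncard = 3 := by
  rintro _ (rfl | ⟨c, p, rfl⟩ | ⟨a, rfl⟩ | ⟨g, t, rfl⟩)
  · exact ncard_range_fin_three (by simp) Sum.inr_injective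
  · refine Set.ncard_eq_three.2 ⟨_, _, _, Sum.inr_ne_inl, Sum.inr_ne_inl, fun h => ?_, rfl⟩
    have := congrArg Prod.fst (Sum.inl_injective h)
    exact act_ne_zero hj0 (p.2 - c) (left_eq_add.1 this)
  · exact ncard_range_fin_three (by simp) fun c d h => congrArg Prod.snd (Sum.inl_injective h)
  · exact ncard_range_fin_three (by simp) fun a b h =>
      hB.point_injective t (T.mul_left_injective g (Sum.inl_injective h))

lemma fixedBlock_inl {A : Type} {p : A × ZMod 3} : Sum.inl p ∉ fixedBlock A := by simp [fixedBlock]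

lemma existsUnique_block_inl (hj : j + j = 0) (hj0 : j ≠ 0) (hj1 : T.act 1 j ≠ j)
    (hB : T.IsCover j B (completeDiffs T j) (completePoints j)) {p q : A × ZMod 3} (hpq : p ≠ q) :
    ∃! b, b ∈ T.blockSet j B ∧ Sum.inl p ∈ b ∧ Sum.inl q ∈ b := by
  by_cases h1 : (T.diff p q).1 = 0
  · have e : p.1 = q.1 := (sub_eq_zero.1 (T.act_eq_zero.1 h1)).symm
    refine ⟨coset p.1, ⟨Or.inr (Or.inr (Or.inl ⟨_, rfl⟩)), inl_mem_coset.2 rfl,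
      inl_mem_coset.2 e⟩, ?_⟩
    rintro _ ⟨rfl | ⟨c, r, rfl⟩ | ⟨a, rfl⟩ | ⟨g, t, rfl⟩, hp, hq⟩
    · exact absurd hp fixedBlock_inl
    · rw [diff_of_mem_axis hj hp hq hpq] at h1
      exact absurd h1 (act_ne_zero hj0 _)
    · rw [inl_mem_coset.1 hp]
    · exact absurd h1 (hB.diff_mem_of_mem_translate hpq hp hq).1
  by_cases h2 : (T.diff p q).2 = 0 ∧ ∃ c, (T.diff p q).1 = T.act c j
  · obtain ⟨h2, c, h3⟩ := h2
    have hd : T.diff p q = (T.act c j, 0) := Prod.ext h3 h2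
    have hq : q = (p.1 + T.act (p.2 - -c) j, p.2) := by
      rw [← T.mul_diff p q, hd]
      simp [mul, T.act_add]
    refine ⟨T.axis j (-c) p, ⟨Or.inr (Or.inl ⟨_, _, rfl⟩), inl_mem_axis.2 (Or.inl rfl),
      inl_mem_axis.2 (Or.inr hq)⟩, ?_⟩
    rintro _ ⟨rfl | ⟨c', r, rfl⟩ | ⟨a, rfl⟩ | ⟨g, t, rfl⟩, hp, hq⟩
    · exact absurd hp fixedBlock_inl
    · have := (diff_of_mem_axis hj hp hq hpq).symm.trans hd
      have e : -c' = c := act_involution_injective hj1 (congrArg Prod.fst this)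
      rw [axis_eq_of_mem hj hp, ← e, neg_neg]
    · exact absurd (diff_of_mem_coset hp hq) h1
    · exact absurd ⟨h2, c, h3⟩ (hB.diff_mem_of_mem_translate hpq hp hq).2
  · have hd : T.diff p q ∈ Set.range (T.diffs B) := by
      rw [hB.range_diffs]
      exact ⟨h1, h2⟩
    obtain ⟨⟨t, ⟨⟨a, b⟩, hab⟩⟩, hd⟩ := hd
    obtain ⟨g, hg⟩ := T.exists_mul_eq (B t a) p
    have hq : T.mul g (B t b) = q := by
      rw [← T.mul_diff p q, ← hd, ← hg, diffs, ← T.diff_mul_mul g, mul_diff]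
    have hp' : Sum.inl p ∈ T.translate B g t := inl_mem_translate.2 ⟨a, hg⟩
    have hq' : Sum.inl q ∈ T.translate B g t := inl_mem_translate.2 ⟨b, hq⟩
    refine ⟨T.translate B g t, ⟨Or.inr (Or.inr (Or.inr ⟨_, _, rfl⟩)), hp', hq'⟩, ?_⟩
    rintro _ ⟨rfl | ⟨c', r, rfl⟩ | ⟨a, rfl⟩ | ⟨h, u, rfl⟩, hp, hq⟩
    · exact absurd hp fixedBlock_inl
    · have := diff_of_mem_axis hj hp hq hpq
      exact absurd ⟨congrArg Prod.snd this, _, congrArg Prod.fst this⟩ h2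
    · exact absurd (diff_of_mem_coset hp hq) h1
    · obtain ⟨rfl, rfl⟩ := hB.translate_unique hpq hp hq hp' hq'
      rfl

lemma existsUnique_block_inr_inl (hj : j + j = 0) (c : ZMod 3) (p : A × ZMod 3) :
    ∃! b, b ∈ T.blockSet j B ∧ Sum.inr c ∈ b ∧ Sum.inl p ∈ b := by
  refine ⟨T.axis j c p, ⟨Or.inr (Or.inl ⟨_, _, rfl⟩), by simp [axis], by simp [axis]⟩, ?_⟩
  rintro _ ⟨rfl | ⟨c', r, rfl⟩ | ⟨a, rfl⟩ | ⟨g, t, rfl⟩, hc, hp⟩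
  · exact absurd hp fixedBlock_inl
  · have : c = c' := by simpa [axis] using hc
    rw [this, axis_eq_of_mem hj hp]
  · simp [coset] at hc
  · simp [translate] at hc

lemma existsUnique_block (hj : j + j = 0) (hj0 : j ≠ 0) (hj1 : T.act 1 j ≠ j)
    (hB : T.IsCover j B (completeDiffs T j) (completePoints j)) (x y : Point A) (hxy : x ≠ y) :
    ∃! b, b ∈ T.blockSet j B ∧ x ∈ b ∧ y ∈ b := by
  rcases x with p | c <;> rcases y with q | d
  · exact existsUnique_block_inl hj hj0 hj1 hB fun h => hxy (by rw [h])
  · simpa only [and_comm (a := Sum.inl p ∈ _)] using existsUnique_block_inr_inl hj d p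
  · exact existsUnique_block_inr_inl hj c q
  · refine ⟨fixedBlock A, ⟨Or.inl rfl, ⟨c, rfl⟩, ⟨d, rfl⟩⟩, ?_⟩
    rintro _ ⟨rfl | ⟨c', r, rfl⟩ | ⟨a, rfl⟩ | ⟨g, t, rfl⟩, hc, hd⟩
    · rfl
    · have h1 : c = c' := by simpa [axis] using hc
      have h2 : d = c' := by simpa [axis] using hd
      exact absurd (by rw [h1, h2]) hxy
    · simp [coset] at hc
    · simp [translate] at hc

end Twist

/-! ### The resolution -/

namespace Twist

variable {A : Type} [AddCommGroup A] {T : Twist A} {j : A} {ι : Type} {B : ι → Fin 3 → A × ZMod 3}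

variable (T j B) in
/-- The resolution of the triple system. -/
def resolutionSet : Set (Set (Set (Point A))) :=
  insert (fixedClass A) (Set.range (T.parallelClass j B))

lemma fixedClass_subset : fixedClass A ⊆ T.blockSet j B := by
  rintro _ (rfl | ⟨a, rfl⟩)
  · exact Or.inl rfl
  · exact Or.inr (Or.inr (Or.inl ⟨a, rfl⟩))

lemma parallelClass_subset (g : A × ZMod 3) : T.parallelClass j B g ⊆ T.blockSet j B := by
  rintro _ (⟨c, rfl⟩ | ⟨t, rfl⟩ | ⟨t, rfl⟩)
  · exact Or.inr (Or.inl ⟨_, _, rfl⟩)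
  · exact Or.inr (Or.inr (Or.inr ⟨_, _, rfl⟩))
  · exact Or.inr (Or.inr (Or.inr ⟨_, _, rfl⟩))

lemma axis_ne_fixedBlock {c : ZMod 3} {p : A × ZMod 3} : T.axis j c p ≠ fixedBlock A := fun h =>
  fixedBlock_inl (p := p) (h ▸ inl_mem_axis.2 (Or.inl rfl))

lemma translate_ne_fixedBlock {g : A × ZMod 3} {t : ι} : T.translate B g t ≠ fixedBlock A :=
  fun h => fixedBlock_inl (p := T.mul g (B t 0)) (h ▸ inl_mem_translate.2 ⟨0, rfl⟩)

lemma fixedBlock_notMem_parallelClass (g : A × ZMod 3) :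
    fixedBlock A ∉ T.parallelClass j B g := by
  rintro (⟨c, h⟩ | ⟨t, h⟩ | ⟨t, h⟩)
  · exact axis_ne_fixedBlock h
  · exact translate_ne_fixedBlock h
  · exact translate_ne_fixedBlock h

lemma axis_ne_coset {c : ZMod 3} {p : A × ZMod 3} {a : A} : T.axis j c p ≠ coset a := fun h => by
  have : Sum.inr c ∈ coset a := h ▸ (by simp [axis] : Sum.inr c ∈ T.axis j c p)
  simp [coset] at this

lemma axis_ne_translate {c : ZMod 3} {p g : A × ZMod 3} {t : ι} :
    T.axis j c p ≠ T.translate B g t := fun h => by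
  have : Sum.inr c ∈ T.translate B g t := h ▸ (by simp [axis] : Sum.inr c ∈ T.axis j c p)
  simp [translate] at this

lemma coset_ne_translate (hB : T.IsCover j B (completeDiffs T j) (completePoints j))
    {a : A} {g : A × ZMod 3} {t : ι} : coset a ≠ T.translate B g t := fun h => by
  have h0 : (Sum.inl (a, 0) : Point A) ∈ coset a := ⟨0, rfl⟩
  have h1 : (Sum.inl (a, 1) : Point A) ∈ coset a := ⟨1, rfl⟩
  have hne : ((a, 0) : A × ZMod 3) ≠ (a, 1) := fun h => by
    exact zero_ne_one (congrArg Prod.snd h)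
  exact (hB.diff_mem_of_mem_translate hne (h ▸ h0) (h ▸ h1)).1 (diff_of_mem_coset h0 h1)

lemma coset_notMem_parallelClass (hB : T.IsCover j B (completeDiffs T j) (completePoints j))
    (a : A) (g : A × ZMod 3) : coset a ∉ T.parallelClass j B g := by
  rintro (⟨c, h⟩ | ⟨t, h⟩ | ⟨t, h⟩)
  · exact axis_ne_coset h
  · exact coset_ne_translate hB h.symm
  · exact coset_ne_translate hB h.symm

/-- A block through a fixed point determines its parallel class: it determines `g` up to right
multiplication by the involution, and `parallelClass_mul` applies. -/
lemma parallelClass_eq_of_axis_mem (hj : j + j = 0) {c : ZMod 3} {p g h : A × ZMod 3}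
    (hp : T.mul h (0, c) = p) (hg : T.axis j c p ∈ T.parallelClass j B g) :
    T.parallelClass j B g = T.parallelClass j B h := by
  rcases hg with ⟨d, hd⟩ | ⟨t, ht⟩ | ⟨t, ht⟩
  · replace hd : T.axis j d (T.mul g (0, d)) = T.axis j c p := hd
    have hcd : c = d := by
      have : Sum.inr c ∈ T.axis j d (T.mul g (0, d)) :=
        hd ▸ (by simp [axis] : Sum.inr c ∈ T.axis j c p)
      simpa [axis] using this
    subst hcd
    have : Sum.inl p ∈ T.axis j c (T.mul g (0, c)) :=
      hd ▸ (by simp [axis] : Sum.inl p ∈ T.axis j c p)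
    rcases inl_mem_axis.1 this with e | e
    · rw [T.mul_right_cancel' (hp.trans e)]
    · rw [← parallelClass_mul hj g]
      congr 1
      refine T.mul_right_cancel' (p := (0, c)) ?_
      rw [hp, e]
      simp [mul]
  · exact absurd ht.symm axis_ne_translate
  · exact absurd ht.symm axis_ne_translate

lemma parallelClass_eq_of_translate_mem (hj : j + j = 0)
    (hB : T.IsCover j B (completeDiffs T j) (completePoints j)) {t : ι} {g h : A × ZMod 3}
    (hg : T.translate B h t ∈ T.parallelClass j B g) :
    T.parallelClass j B g = T.parallelClass j B h := by
  rcases hg with ⟨d, hd⟩ | ⟨u, hu⟩ | ⟨u, hu⟩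
  · exact absurd hd axis_ne_translate
  · rw [(hB.translate_injective hu).1]
  · rw [← (hB.translate_injective hu).1, parallelClass_mul hj]

lemma existsUnique_class (hj : j + j = 0)
    (hB : T.IsCover j B (completeDiffs T j) (completePoints j)) :
    ∀ b ∈ T.blockSet j B, ∃! P, P ∈ T.resolutionSet j B ∧ b ∈ P := by
  rintro _ (rfl | ⟨c, p, rfl⟩ | ⟨a, rfl⟩ | ⟨g, t, rfl⟩)
  · refine ⟨fixedClass A, ⟨Or.inl rfl, Or.inl rfl⟩, ?_⟩
    rintro _ ⟨rfl | ⟨g, rfl⟩, h⟩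
    · rfl
    · exact absurd h (fixedBlock_notMem_parallelClass g)
  · obtain ⟨h, hh⟩ := T.exists_mul_eq (0, c) p
    refine ⟨T.parallelClass j B h, ⟨Or.inr ⟨h, rfl⟩, Or.inl ⟨c, by rw [← hh]⟩⟩, ?_⟩
    rintro _ ⟨rfl | ⟨g, rfl⟩, hg⟩
    · rcases hg with hg | ⟨a, hg⟩
      · exact absurd hg axis_ne_fixedBlock
      · exact absurd hg.symm axis_ne_coset
    · exact parallelClass_eq_of_axis_mem hj hh hg
  · refine ⟨fixedClass A, ⟨Or.inl rfl, Or.inr ⟨a, rfl⟩⟩, ?_⟩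
    rintro _ ⟨rfl | ⟨g, rfl⟩, h⟩
    · rfl
    · exact absurd h (coset_notMem_parallelClass hB a g)
  · refine ⟨T.parallelClass j B g, ⟨Or.inr ⟨g, rfl⟩, Or.inr (Or.inl ⟨t, rfl⟩)⟩, ?_⟩
    rintro _ ⟨rfl | ⟨h, rfl⟩, hg⟩
    · rcases hg with hg | ⟨a, hg⟩
      · exact absurd hg translate_ne_fixedBlock
      · exact absurd hg (coset_ne_translate hB)
    · exact parallelClass_eq_of_translate_mem hj hB hg

lemma empty_notMem_blockSet : ∅ ∉ T.blockSet j B := by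
  rintro (h | ⟨c, p, h⟩ | ⟨a, h⟩ | ⟨g, t, h⟩)
  · exact (h ▸ ⟨0, rfl⟩ : Sum.inr 0 ∈ (∅ : Set (Point A)))
  · exact (h ▸ (by simp [axis]) : Sum.inr c ∈ (∅ : Set (Point A)))
  · exact (h ▸ ⟨0, rfl⟩ : Sum.inl (a, 0) ∈ (∅ : Set (Point A)))
  · exact (h ▸ ⟨0, rfl⟩ : Sum.inl (T.mul g (B t 0)) ∈ (∅ : Set (Point A)))

lemma fixedClass_isPartition {A : Type} : Setoid.IsPartition (fixedClass A) := by
  refine ⟨?_, ?_⟩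
  · rintro (h | ⟨a, h⟩)
    · exact (h ▸ ⟨0, rfl⟩ : Sum.inr 0 ∈ (∅ : Set (Point A)))
    · exact (h ▸ ⟨0, rfl⟩ : Sum.inl (a, 0) ∈ (∅ : Set (Point A)))
  · rintro (p | c)
    · refine ⟨coset p.1, ⟨Or.inr ⟨_, rfl⟩, inl_mem_coset.2 rfl⟩, ?_⟩
      rintro _ ⟨rfl | ⟨a, rfl⟩, h⟩
      · exact absurd h fixedBlock_inl
      · rw [inl_mem_coset.1 h]
    · refine ⟨fixedBlock A, ⟨Or.inl rfl, ⟨c, rfl⟩⟩, ?_⟩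
      rintro _ ⟨rfl | ⟨a, rfl⟩, h⟩
      · rfl
      · simp [coset] at h

lemma inl_mem_axis_class {g q : A × ZMod 3} {c : ZMod 3} :
    Sum.inl (T.mul g q) ∈ T.axis j c (T.mul g (0, c)) ↔ (q.1 = 0 ∨ q.1 = j) ∧ q.2 = c := by
  have e : ((T.mul g (0, c)).1 + T.act ((T.mul g (0, c)).2 - c) j, (T.mul g (0, c)).2) =
      T.mul g (j, c) := by simp [mul]
  rw [inl_mem_axis, e, (T.mul_left_injective g).eq_iff, (T.mul_left_injective g).eq_iff]
  simp [Prod.ext_iff, or_and_right]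

lemma parallelClass_isPartition (hB : T.IsCover j B (completeDiffs T j) (completePoints j))
    (g : A × ZMod 3) : Setoid.IsPartition (T.parallelClass j B g) := by
  refine ⟨fun h => empty_notMem_blockSet (parallelClass_subset g h), ?_⟩
  have hmem : ∀ {q t} {ε : Bool},
      Sum.inl (T.mul g q) ∈ T.translate B (cond ε (T.mul g (j, 0)) g) t ↔
        ∃ i, shift j (B t i) ε = q := fun {q t ε} => by
    simp_rw [inl_mem_translate, mul_involution, (T.mul_left_injective g).eq_iff]
  have hS : ∀ {t i ε}, shift j (B t i) ε ∈ completePoints j := fun {t i ε} => by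
    rw [← hB.range_points]
    exact ⟨(t, i, ε), rfl⟩
  rintro (p | c)
  · obtain ⟨q, rfl⟩ : ∃ q, T.mul g q = p := ⟨_, T.mul_inv_cancel_left g p⟩
    by_cases hq : q.1 = 0 ∨ q.1 = j
    · refine ⟨T.axis j q.2 (T.mul g (0, q.2)), ⟨Or.inl ⟨_, rfl⟩,
        inl_mem_axis_class.2 ⟨hq, rfl⟩⟩, ?_⟩
      have hno : ∀ {t} {ε : Bool},
          Sum.inl (T.mul g q) ∉ T.translate B (cond ε (T.mul g (j, 0)) g) t := fun {t ε} h => by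
        obtain ⟨i, rfl⟩ := hmem.1 h
        exact not_or.2 hS hq
      rintro _ ⟨⟨c, rfl⟩ | ⟨t, rfl⟩ | ⟨t, rfl⟩, h⟩
      · rw [(inl_mem_axis_class.1 h).2]
      · exact absurd h (hno (ε := false))
      · exact absurd h (hno (ε := true))
    · have hq' : q ∈ Set.range (points j B) := by
        rw [hB.range_points]
        exact not_or.1 hq
      obtain ⟨⟨t, i, ε⟩, hi⟩ := hq'
      have huniq : ∀ {u} {δ : Bool},
          Sum.inl (T.mul g q) ∈ T.translate B (cond δ (T.mul g (j, 0)) g) u →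
          T.translate B (cond δ (T.mul g (j, 0)) g) u =
            T.translate B (cond ε (T.mul g (j, 0)) g) t := fun {u δ} h => by
        obtain ⟨k, hk⟩ := hmem.1 h
        have := hB.points_injective (a₁ := (u, k, δ)) (a₂ := (t, i, ε)) (hk.trans hi.symm)
        simp only [Prod.mk.injEq] at this
        rw [this.1, this.2.2]
      refine ⟨T.translate B (cond ε (T.mul g (j, 0)) g) t, ⟨Or.inr ?_, hmem.2 ⟨i, hi⟩⟩, ?_⟩
      · cases ε
        · exact Or.inl ⟨t, rfl⟩
        · exact Or.inr ⟨t, rfl⟩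
      · rintro _ ⟨⟨c, rfl⟩ | ⟨u, rfl⟩ | ⟨u, rfl⟩, h⟩
        · exact absurd (inl_mem_axis_class.1 h).1 hq
        · exact huniq (δ := false) h
        · exact huniq (δ := true) h
  · refine ⟨T.axis j c (T.mul g (0, c)), ⟨Or.inl ⟨c, rfl⟩, by simp [axis]⟩, ?_⟩
    rintro _ ⟨⟨d, rfl⟩ | ⟨t, rfl⟩ | ⟨t, rfl⟩, h⟩
    · have : c = d := by simpa [axis] using h
      rw [this]
    · simp [translate] at h
    · simp [translate] at h

/-- The Kirkman triple system of a complete cover. -/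
def kirkman (hj : j + j = 0) (hj0 : j ≠ 0) (hj1 : T.act 1 j ≠ j)
    (hB : T.IsCover j B (completeDiffs T j) (completePoints j)) :
    KirkmanTripleSystem (Point A) where
  blocks := T.blockSet j B
  ncard_block := ncard_block hj0 hB
  existsUnique_block := existsUnique_block hj hj0 hj1 hB
  resolution := T.resolutionSet j B
  class_nonempty := by
    rintro _ (rfl | ⟨g, rfl⟩)
    · exact ⟨_, Or.inl rfl⟩
    · exact ⟨_, Or.inl ⟨0, rfl⟩⟩
  class_subset := by
    rintro _ (rfl | ⟨g, rfl⟩)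
    · exact fixedClass_subset
    · exact parallelClass_subset g
  existsUnique_class := existsUnique_class hj hB
  class_isPartition := by
    rintro _ (rfl | ⟨g, rfl⟩)
    · exact fixedClass_isPartition
    · exact parallelClass_isPartition hB g

/-! ### Automorphisms -/

lemma smul_range {κ : Type} (g : A × ZMod 3) (f : κ → Point A) :
    T.perm g • Set.range f = Set.range fun k => T.perm g (f k) := by
  rw [← Set.image_smul, ← Set.range_comp]
  rfl

lemma smul_fixedBlock (g : A × ZMod 3) : T.perm g • fixedBlock A = fixedBlock A :=
  smul_range g _

lemma smul_coset (g : A × ZMod 3) (a : A) :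
    T.perm g • coset a = coset (T.mul g (a, 0)).1 := by
  rw [coset, smul_range]
  ext x
  constructor
  · rintro ⟨c, rfl⟩
    exact ⟨g.2 + c, by simp [mul]⟩
  · rintro ⟨c, rfl⟩
    exact ⟨c - g.2, by simp [mul]⟩

lemma smul_axis (g p : A × ZMod 3) (c : ZMod 3) :
    T.perm g • T.axis j c p = T.axis j c (T.mul g p) := by
  have : T.act (g.2 + p.2 - c) j = T.act g.2 (T.act (p.2 - c) j) := by
    rw [← T.act_add, add_sub_assoc]
  simp [axis, ← Set.image_smul, Set.image_insert_eq, mul, this, add_assoc]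

lemma smul_translate (g h : A × ZMod 3) (t : ι) :
    T.perm g • T.translate B h t = T.translate B (T.mul g h) t := by
  rw [translate, smul_range]
  simp [translate, mul_assoc']

lemma smul_fixedClass (g : A × ZMod 3) : T.perm g • fixedClass A ⊆ fixedClass A := by
  rintro _ ⟨b, rfl | ⟨a, rfl⟩, rfl⟩
  · exact Or.inl (smul_fixedBlock g)
  · exact Or.inr ⟨_, (smul_coset g a).symm⟩

lemma smul_parallelClass (g h : A × ZMod 3) :
    T.perm g • T.parallelClass j B h = T.parallelClass j B (T.mul g h) := by
  have hr : ∀ {κ : Type} (f : κ → Set (Point A)),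
      T.perm g • Set.range f = Set.range fun k => T.perm g • f k := fun f => by
    rw [← Set.image_smul, ← Set.range_comp]
    rfl
  simp only [parallelClass, Set.smul_set_union, hr, smul_axis, smul_translate, mul_assoc']

lemma perm_inv (g : A × ZMod 3) : (T.perm g)⁻¹ = T.perm (T.inv g) := by
  ext (p | c) <;> rfl

lemma smul_resolutionSet (g : A × ZMod 3) :
    T.perm g • T.resolutionSet j B = T.resolutionSet j B := by
  have hsub : ∀ h, T.perm h • T.resolutionSet j B ⊆ T.resolutionSet j B := by
    rintro h _ ⟨P, rfl | ⟨k, rfl⟩, rfl⟩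
    · refine Or.inl (Set.Subset.antisymm (smul_fixedClass h) ?_)
      rw [Set.subset_smul_set_iff, perm_inv]
      exact smul_fixedClass _
    · exact Or.inr ⟨_, (smul_parallelClass h k).symm⟩
  refine Set.Subset.antisymm (hsub g) ?_
  rw [Set.subset_smul_set_iff, perm_inv]
  exact hsub _

/-- A complete cover yields a 3-pyramidal Kirkman triple system. -/
theorem Complete.exists_kirkman [Finite A] (h : T.Complete j) (hj : j + j = 0) (hj0 : j ≠ 0)
    (hj1 : T.act 1 j ≠ j) : ∃ (V : Type) (_ : Fintype V), Fintype.card V = 3 * Nat.card A + 3 ∧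
      ∃ K : KirkmanTripleSystem V, K.IsPyramidal 3 ∧
        Fintype.card V - 3 ≤ Nat.card K.autGroup := by
  obtain ⟨ι, B, hB⟩ := h
  have := Fintype.ofFinite A
  have hcard : Fintype.card (Point A) = 3 * Nat.card A + 3 := by
    simp [Point, mul_comm]
  refine ⟨Point A, inferInstance, hcard, kirkman hj hj0 hj1 hB, ⟨T.permGroup, ?_, ?_⟩, ?_⟩
  · rintro _ ⟨g, rfl⟩
    exact MulAction.mem_stabilizer_iff.2 (smul_resolutionSet g)
  · classical
    refine ⟨Finset.univ.map ⟨Sum.inr, Sum.inr_injective⟩, by simp, ?_, ?_⟩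
    · rintro _ ⟨g, rfl⟩ x hx
      obtain ⟨c, -, rfl⟩ := Finset.mem_map.1 hx
      rfl
    · rintro (p | c) (q | d) hx hy
      · obtain ⟨g, hg⟩ := T.exists_mul_eq p q
        refine ⟨T.perm g, ⟨⟨g, rfl⟩, by simp [hg]⟩, ?_⟩
        rintro _ ⟨⟨h, rfl⟩, hh⟩
        rw [T.mul_right_cancel' ((Sum.inl_injective hh).trans hg.symm)]
      all_goals simp at hx hy
  · rw [hcard, Nat.add_sub_cancel]
    have hinj : Function.Injective fun g : A × ZMod 3 =>
        (⟨T.perm g, MulAction.mem_stabilizer_iff.2 (smul_resolutionSet g)⟩ :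
          (kirkman hj hj0 hj1 hB).autGroup) := fun g h e => by
      have e' := congrArg (fun x => x.1 (Sum.inl (0 : A × ZMod 3))) e
      exact T.mul_right_cancel' (Sum.inl_injective e')
    calc 3 * Nat.card A = Nat.card (A × ZMod 3) := by
          rw [Nat.card_prod, Nat.card_zmod, mul_comm]
      _ ≤ _ := Nat.card_le_card_of_injective _ hinj

end Twist

/-! ### Multiplying covers by rings -/

namespace Twist

variable {A : Type} [AddCommGroup A]

/-- The action on `A × W` that is trivial on the second factor. -/
def prod (T : Twist A) (W : Type) [AddCommGroup W] : Twist (A × W) where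
  act c := (T.act c).prodMap (AddMonoidHom.id W)
  act_zero := by rintro ⟨a, w⟩; simp [T.act_zero]
  act_add := by rintro c d ⟨a, w⟩; simp [T.act_add]

@[simp] lemma prod_act (T : Twist A) (W : Type) [AddCommGroup W] (c : ZMod 3) (x : A × W) :
    (T.prod W).act c x = (T.act c x.1, x.2) := rfl

variable {T : Twist A} {j : A}

/-- Each block is repeated with the `W`-coordinates `u i a * x`, where `x` runs through `X`. -/
lemma HasCover.of_multipliers {W : Type} [CommRing W] {ι : Type} (B : ι → Fin 3 → A × ZMod 3)
    (u : ι → Fin 3 → W) (X : Set W) {D S : Set ((A × ZMod 3) × W)}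
    (hd : Function.Injective fun z : (ι × Pairs) × X =>
      (T.diffs B z.1, (u z.1.1 z.1.2.1.2 - u z.1.1 z.1.2.1.1) * (z.2 : W)))
    (hD : (Set.range fun z : (ι × Pairs) × X =>
      (T.diffs B z.1, (u z.1.1 z.1.2.1.2 - u z.1.1 z.1.2.1.1) * (z.2 : W))) = D)
    (hp : Function.Injective fun z : (ι × Fin 3 × Bool) × X =>
      (points j B z.1, u z.1.1 z.1.2.1 * (z.2 : W)))
    (hS : (Set.range fun z : (ι × Fin 3 × Bool) × X =>
      (points j B z.1, u z.1.1 z.1.2.1 * (z.2 : W))) = S) :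
    (T.prod W).HasCover (j, 0) {p | ((p.1.1, p.2), p.1.2) ∈ D} {p | ((p.1.1, p.2), p.1.2) ∈ S} := by
  let e : (A × W) × ZMod 3 → (A × ZMod 3) × W := fun p => ((p.1.1, p.2), p.1.2)
  have he : Function.Bijective e :=
    Function.bijective_iff_has_inverse.2
      ⟨fun p => ((p.1.1, p.2), p.1.2), fun _ => rfl, fun _ => rfl⟩
  let C : ι × X → Fin 3 → (A × W) × ZMod 3 := fun y a => (((B y.1 a).1, u y.1 a * y.2), (B y.1 a).2)
  let r : (ι × X) × Pairs → (ι × Pairs) × X := fun x => ((x.1.1, x.2), x.1.2)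
  let r' : (ι × X) × Fin 3 × Bool → (ι × Fin 3 × Bool) × X := fun x => ((x.1.1, x.2), x.1.2)
  have hr : Function.Bijective r :=
    Function.bijective_iff_has_inverse.2
      ⟨fun p => ((p.1.1, p.2), p.1.2), fun _ => rfl, fun _ => rfl⟩
  have hr' : Function.Bijective r' :=
    Function.bijective_iff_has_inverse.2
      ⟨fun p => ((p.1.1, p.2), p.1.2), fun _ => rfl, fun _ => rfl⟩
  have key : ∀ {α β : Type} {s : α → β} {f : α → (A × W) × ZMod 3} {g : β → (A × ZMod 3) × W}
      {R : Set ((A × ZMod 3) × W)}, Function.Bijective s → e ∘ f = g ∘ s →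
      Function.Injective g → Set.range g = R → Function.Injective f ∧ Set.range f = e ⁻¹' R := by
    intro α β s f g R hs h hg hR
    refine ⟨Function.Injective.of_comp (f := e) (h ▸ hg.comp hs.1), ?_⟩
    rw [← hR, ← hs.2.range_comp g, ← h, Set.range_comp, Set.preimage_image_eq _ he.1]
  have h1 := key hr (f := (T.prod W).diffs C)
    (by ext x <;> simp [e, r, C, diffs, diff, sub_mul]) hd hD
  have h2 := key hr' (f := points (j, 0) C) (by
    ext ⟨y, a, ε⟩
    · cases ε <;> simp [e, r', C, points, shift]
    · simp [e, r', C, points, shift]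
    · cases ε <;> simp [e, r', C, points, shift]) hp hS
  exact ⟨_, C, h1.1, h1.2, h2.1, h2.2⟩

/-- Three units of `W` with invertible differences. They multiply covers by `W` homogeneously. -/
def Homogeneous (W : Type) [CommRing W] : Prop :=
  ∃ t : Fin 3 → W, (∀ a, IsUnit (t a)) ∧ ∀ a b, a ≠ b → IsUnit (t b - t a)

lemma Homogeneous.prod {W W' : Type} [CommRing W] [CommRing W'] (h : Homogeneous W)
    (h' : Homogeneous W') : Homogeneous (W × W') := by
  obtain ⟨t, h1, h2⟩ := h
  obtain ⟨t', h1', h2'⟩ := h'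
  exact ⟨fun a => (t a, t' a), fun a => Prod.isUnit_iff.2 ⟨h1 a, h1' a⟩,
    fun a b hab => Prod.isUnit_iff.2 ⟨h2 a b hab, h2' a b hab⟩⟩

lemma HasCover.prod {W : Type} [CommRing W] (hW : Homogeneous W) {D S : Set (A × ZMod 3)}
    (h : T.HasCover j D S) :
    (T.prod W).HasCover (j, 0) {p | (p.1.1, p.2) ∈ D} {p | (p.1.1, p.2) ∈ S} := by
  obtain ⟨ι, B, hB⟩ := h
  obtain ⟨t, h1, h2⟩ := hW
  have key : ∀ {α : Type} {f : α → A × ZMod 3} {R : Set (A × ZMod 3)} (m : α → W),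
      (∀ x, IsUnit (m x)) → Function.Injective f → Set.range f = R →
      (Function.Injective fun z : α × (Set.univ : Set W) => (f z.1, m z.1 * (z.2 : W))) ∧
      (Set.range fun z : α × (Set.univ : Set W) => (f z.1, m z.1 * (z.2 : W))) =
        {p | p.1 ∈ R} := by
    intro α f R m hm hf hR
    constructor
    · rintro ⟨x, w, hw⟩ ⟨y, w', hw'⟩ h
      obtain ⟨hxy, hww⟩ := Prod.mk.inj h
      obtain rfl := hf hxy
      obtain rfl := (hm x).mul_left_cancel hww
      rfl
    · ext ⟨p, w⟩
      simp only [← hR]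
      constructor
      · rintro ⟨z, hz⟩
        exact ⟨z.1, congrArg Prod.fst hz⟩
      · rintro ⟨x, hx⟩
        obtain ⟨n, hn⟩ := hm x
        refine ⟨(x, ⟨↑n⁻¹ * w, trivial⟩), Prod.ext hx ?_⟩
        simp [← hn]
  have hd := key (fun x : ι × Pairs => t x.2.1.2 - t x.2.1.1) (fun x => h2 _ _ x.2.2)
    hB.diffs_injective hB.range_diffs
  have hp := key (fun x : ι × Fin 3 × Bool => t x.2.1) (fun x => h1 _)
    hB.points_injective hB.range_points
  exact HasCover.of_multipliers B (fun _ => t) Set.univ hd.1 hd.2 hp.1 hp.2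

lemma RelCover.prod {W : Type} [CommRing W] (hW : Homogeneous W) {H : Set A}
    (h : T.RelCover j H) : (T.prod W).RelCover (j, 0) {x | x.1 ∈ H} :=
  HasCover.prod hW h

/-- Multiplication by `W` relative to `A` itself. -/
def RelProd (T : Twist A) (j : A) (W : Type) [CommRing W] : Prop :=
  (T.prod W).RelCover (j, 0) {x | x.2 = 0}

lemma Complete.prod {W : Type} [CommRing W] (h : T.Complete j) (hW : T.RelProd j W) :
    (T.prod W).Complete (j, 0) := by
  refine h.of_relCover (AddMonoidHom.inl A W) (fun a b h => congrArg Prod.fst h)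
    (fun c a => rfl) rfl ?_
  have : Set.range (AddMonoidHom.inl A W) = {x | x.2 = 0} := by
    ext ⟨a, w⟩
    simp [eq_comm]
  rwa [this]

lemma RelProd.prod {W W' : Type} [CommRing W] [CommRing W'] (hW' : Homogeneous W')
    (h : T.RelProd j W) (h' : T.RelProd j W') : T.RelProd j (W × W') := by
  let φ : (A × W) × W' →+ A × (W × W') := (AddEquiv.prodAssoc : (A × W) × W' ≃+ A × (W × W'))
  let ψ : A × W' →+ A × (W × W') := (AddMonoidHom.id A).prodMap (AddMonoidHom.inr W W')
  have h1 := (RelCover.prod hW' h).map (T' := T.prod (W × W')) (j' := (j, 0)) φ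
    (AddEquiv.injective _) (fun _ _ => rfl) rfl
  have h2 := HasCover.map (T' := T.prod (W × W')) (j' := (j, 0)) ψ
    (fun a b h => by simpa [ψ, Prod.ext_iff] using h) (fun _ _ => rfl) rfl h'
  have e1 : Prod.map φ (id : ZMod 3 → ZMod 3) '' {p | p.1 ∉ {x | x.1 ∈ {x | x.2 = 0}}} =
      {p | p.1.2.1 ≠ 0} := by
    ext ⟨⟨a, w, w'⟩, c⟩
    constructor
    · rintro ⟨p, hp, h⟩
      rw [← h]
      exact hp
    · intro hp
      exact ⟨(((a, w), w'), c), hp, rfl⟩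
  have e2 : Prod.map ψ (id : ZMod 3 → ZMod 3) '' {p | p.1 ∉ {x | x.2 = 0}} =
      {p | p.1.2.1 = 0 ∧ p.1.2.2 ≠ 0} := by
    ext ⟨⟨a, w, w'⟩, c⟩
    constructor
    · rintro ⟨p, hp, h⟩
      rw [← h]
      exact ⟨rfl, hp⟩
    · rintro ⟨hw, hp⟩
      obtain rfl : w = 0 := hw
      exact ⟨((a, w'), c), hp, rfl⟩
  rw [e1] at h1
  rw [e2] at h2
  have hdisj : Disjoint {p : (A × W × W') × ZMod 3 | p.1.2.1 ≠ 0}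
      {p | p.1.2.1 = 0 ∧ p.1.2.2 ≠ 0} := by
    rw [Set.disjoint_left]
    rintro p hp ⟨hp', -⟩
    exact hp hp'
  have e3 : {p : (A × W × W') × ZMod 3 | p.1.2.1 ≠ 0} ∪ {p | p.1.2.1 = 0 ∧ p.1.2.2 ≠ 0} =
      {p | p.1 ∉ {x | x.2 = 0}} := by
    ext ⟨⟨a, w, w'⟩, c⟩
    simp only [Set.mem_union, Set.mem_ofPred_eq, Prod.mk_eq_zero]
    tauto
  have h3 := h1.union h2 hdisj hdisj
  rw [e3] at h3
  exact h3

lemma relProd_of_subsingleton (W : Type) [CommRing W] [Subsingleton W] : T.RelProd j W := by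
  have : {p : (A × W) × ZMod 3 | p.1 ∉ {x : A × W | x.2 = 0}} = ∅ := by
    ext p
    simp [Subsingleton.elim p.1.2 0]
  unfold RelProd RelCover
  rw [this]
  exact ⟨Empty, fun i => i.elim, fun x => x.1.elim, Set.range_eq_empty _, fun x => x.1.elim,
    Set.range_eq_empty _⟩

/-- A bijection onto `G × L` turns into one onto `G × Fˣ` when the elements of `L` label the parts
of a partition of `Fˣ` into multiples `v l • X` of one set. -/
lemma bijective_labels {I G L F : Type} [Field F] {f : I → G} {ℓ : I → L}
    (hf : Function.Bijective fun i => (f i, ℓ i)) {X : Set F} {v : L → F}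
    (hv : ∀ z : F, z ≠ 0 → ∃! y : L × F, y.2 ∈ X ∧ v y.1 * y.2 = z)
    (hX : ∀ l, ∀ x ∈ X, v l * x ≠ 0) {c : G → F} (hc : ∀ g, c g ≠ 0) {m : I → F}
    (hm : ∀ i, ∃ s, s ≠ 0 ∧ (∀ x, s * x ∈ X ↔ x ∈ X) ∧ m i = c (f i) * v (ℓ i) * s) :
    (Function.Injective fun z : I × X => (f z.1, m z.1 * (z.2 : F))) ∧
      (Set.range fun z : I × X => (f z.1, m z.1 * (z.2 : F))) = {p | p.2 ≠ 0} := by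
  have hne : ∀ i, ∀ x ∈ X, m i * x ≠ 0 := fun i x hx => by
    obtain ⟨s, hs, hsX, e⟩ := hm i
    rw [e, mul_assoc, mul_assoc]
    exact mul_ne_zero (hc _) (hX _ _ ((hsX x).2 hx))
  constructor
  · rintro ⟨i, x, hx⟩ ⟨k, y, hy⟩ h
    obtain ⟨hik, hxy⟩ := Prod.mk.inj h
    replace hxy : m i * x = m k * y := hxy
    obtain ⟨s, hs, hsX, e⟩ := hm i
    obtain ⟨s', hs', hsX', e'⟩ := hm k
    have h0 : v (ℓ i) * (s * x) = v (ℓ k) * (s' * y) := by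
      apply mul_left_cancel₀ (hc (f i))
      have : f k = f i := hik.symm
      rw [e, e', this] at hxy
      simpa only [mul_assoc] using hxy
    have h1 := (hv _ (hX (ℓ i) _ ((hsX x).2 hx))).unique
      (y₁ := (ℓ i, s * x)) (y₂ := (ℓ k, s' * y)) ⟨(hsX x).2 hx, rfl⟩ ⟨(hsX' y).2 hy, h0.symm⟩
    obtain rfl := hf.1 (a₁ := i) (a₂ := k) (Prod.ext hik (congrArg Prod.fst h1))
    have hmi : m i ≠ 0 := left_ne_zero_of_mul (hne i x hx)
    obtain rfl := mul_left_cancel₀ hmi hxy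
    rfl
  · ext ⟨g, z⟩
    constructor
    · rintro ⟨⟨i, x, hx⟩, h⟩
      obtain ⟨-, rfl⟩ := Prod.mk.inj h
      exact hne i x hx
    · intro hz
      obtain ⟨⟨l, x⟩, ⟨hx, h⟩, -⟩ := hv (z / c g) (div_ne_zero hz (hc g))
      obtain ⟨i, hi⟩ := hf.2 (g, l)
      obtain ⟨rfl, rfl⟩ := Prod.mk.inj hi
      obtain ⟨s, hs, hsX, e⟩ := hm i
      refine ⟨(i, ⟨s⁻¹ * x, (hsX _).1 ?_⟩), Prod.ext rfl ?_⟩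
      · rwa [mul_inv_cancel_left₀ hs]
      · have h' : v (ℓ i) * x = z / c (f i) := h
        show m i * (s⁻¹ * x) = z
        rw [e, mul_assoc, mul_inv_cancel_left₀ hs, mul_assoc, h', mul_div_cancel₀ _ (hc _)]

/-- A family of triples with multipliers in a field `F`, such that the multipliers of each point,
and the differences of multipliers of each quotient, fill the labels, multiplies by `F`. -/
lemma relProd_of_labels {F L ι : Type} [Field F] {B : ι → Fin 3 → A × ZMod 3}
    {u : ι → Fin 3 → F} {ℓ : ι → Fin 3 → L} {δ : ι → Pairs → L}
    (hp : Function.Bijective fun x : ι × Fin 3 × Bool => (points j B x, ℓ x.1 x.2.1))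
    (hd : Function.Bijective fun x : ι × Pairs => (T.diffs B x, δ x.1 x.2))
    {X : Set F} {v : L → F} (hv : ∀ z : F, z ≠ 0 → ∃! y : L × F, y.2 ∈ X ∧ v y.1 * y.2 = z)
    (hX : ∀ l, ∀ x ∈ X, v l * x ≠ 0) {c : A × ZMod 3 → F} (hc : ∀ g, c g ≠ 0)
    (hu : ∀ i a, ∃ s, s ≠ 0 ∧ (∀ x, s * x ∈ X ↔ x ∈ X) ∧ u i a = v (ℓ i a) * s)
    (hδ : ∀ i (x : Pairs), ∃ s, s ≠ 0 ∧ (∀ x, s * x ∈ X ↔ x ∈ X) ∧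
      u i x.1.2 - u i x.1.1 = c (T.diffs B (i, x)) * v (δ i x) * s) :
    T.RelProd j F := by
  have h1 := bijective_labels hd hv hX hc (m := fun x => u x.1 x.2.1.2 - u x.1 x.2.1.1)
    fun x => hδ x.1 x.2
  have h2 := bijective_labels hp hv hX (c := fun _ => 1) (fun _ => one_ne_zero)
    (m := fun x => u x.1 x.2.1) fun x => by simpa using hu x.1 x.2.1
  exact HasCover.of_multipliers B u X h1.1 h1.2 h2.1 h2.2

end Twist

namespace Twist

/-! ### Lifting relative covers along quotient maps -/

/-- A difference matrix with three rows over `M` whose columns fall into two halves (indexed by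
`Bool`), such that in each half every row is a transversal of the cosets of `{0, j}`. -/
def Splittable (M : Type) [AddCommGroup M] (j : M) : Prop :=
  ∃ (Q : Type) (k : Bool × Q → Fin 3 → M),
    (∀ a b, a ≠ b → Function.Bijective fun x => k x b - k x a) ∧
    ∀ h a, Function.Bijective fun y : Q × Bool => k (h, y.1) a + cond y.2 j 0

variable {A : Type} [AddCommGroup A] {T : Twist A} {j : A}

/-- A relative cover of a quotient of `A` lifts to `A` by a splittable difference matrix over the
kernel: the columns in one half of the matrix are used for a block of the quotient, those in the
other half for its translate by the involution of the quotient. -/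
lemma RelCover.lift {A' M : Type} [AddCommGroup A'] [AddCommGroup M] {T' : Twist A'} {j' : A'}
    {jM : M} (hM : Splittable M jM) (κ : M →+ A) (hκ : Function.Injective κ) (hj : κ jM = j)
    (π : A →+ A') (hπ : Function.Surjective π) (hker : ∀ a, π a = 0 → ∃ m, κ m = a)
    (hπκ : ∀ m, π (κ m) = 0) (hT : ∀ c a, π (T.act c a) = T'.act c (π a)) {H : Set A'}
    (h : T'.RelCover j' H) : T.RelCover j {a | π a ∈ H} := by
  obtain ⟨Q, k, hk, hk'⟩ := hM
  obtain ⟨ι, B, hB⟩ := h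
  obtain ⟨s, hs⟩ := hπ.hasRightInverse
  -- `s j'` may fail to be an involution: the second half of the matrix uses it only once
  let C : ι × (Bool × Q) → Fin 3 → A × ZMod 3 := fun x a =>
    (κ (k x.2 a) + s (B x.1 a).1 + cond x.2.1 (s j') 0, (B x.1 a).2)
  have hd : ∀ (x : ι × (Bool × Q)) (p : Pairs), T.diffs C (x, p) =
      (T.act (-(B x.1 p.1.1).2) (κ (k x.2 p.1.2 - k x.2 p.1.1) +
        (s (B x.1 p.1.2).1 - s (B x.1 p.1.1).1)), (B x.1 p.1.2).2 - (B x.1 p.1.1).2) := by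
    intro x p
    refine Prod.ext (congrArg (T.act _) ?_) rfl
    simp only [C, map_sub]
    abel
  have hpt : ∀ (t : ι) (b : Bool) (q : Q) (a : Fin 3) (ε : Bool),
      points j C ((t, (b, q)), a, ε) =
        (κ (k (b, q) a + cond ε jM 0) + (s (B t a).1 + cond b (s j') 0), (B t a).2) := by
    intro t b q a ε
    have : κ (cond ε jM 0) = cond ε j 0 := by cases ε <;> simp [hj]
    simp only [points, shift, C, map_add, this]
    congr 1
    abel
  have hd' : ∀ (x : ι × (Bool × Q)) (p : Pairs),
      Prod.map π id (T.diffs C (x, p)) = T'.diffs B (x.1, p) := by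
    intro x p
    rw [hd]
    simp [diffs, diff, hT, hπκ, hs _]
  have hpt' : ∀ (t : ι) (b : Bool) (q : Q) (a : Fin 3) (ε : Bool),
      Prod.map π id (points j C ((t, (b, q)), a, ε)) = points j' B (t, a, b) := by
    intro t b q a ε
    rw [hpt]
    cases b <;> simp [points, shift, hπκ, hs _]
  refine ⟨_, C, ?_, ?_, ?_, ?_⟩
  · rintro ⟨⟨t, x⟩, p⟩ ⟨⟨u, y⟩, p'⟩ e
    have e' := congrArg (Prod.map π id) e
    rw [hd', hd'] at e'
    obtain ⟨rfl, rfl⟩ := Prod.mk.inj (hB.diffs_injective e')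
    rw [hd, hd] at e
    have e1 := T.act_injective _ (congrArg Prod.fst e)
    obtain rfl := (hk _ _ p.2).1 (hκ (add_right_cancel e1))
    rfl
  · ext ⟨a, c⟩
    constructor
    · rintro ⟨⟨x, p⟩, e⟩
      have e' := congrArg (fun z => (Prod.map π id z).1) e
      rw [hd'] at e'
      have hm : T'.diffs B (x.1, p) ∈ {p | p.1 ∉ H} := hB.range_diffs ▸ ⟨_, rfl⟩
      intro ha
      exact hm (e' ▸ ha)
    · intro ha
      have hm : (π a, c) ∈ Set.range (T'.diffs B) := hB.range_diffs ▸ ha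
      obtain ⟨⟨t, p⟩, hp⟩ := hm
      obtain ⟨m, hm⟩ := hker (T.act (B t p.1.1).2 a - (s (B t p.1.2).1 - s (B t p.1.1).1)) (by
        have h1 : T'.act (-(B t p.1.1).2) ((B t p.1.2).1 - (B t p.1.1).1) = π a :=
          congrArg Prod.fst hp
        rw [map_sub, hT, ← h1, act_act_neg, map_sub, hs, hs, sub_self])
      obtain ⟨x, rfl⟩ := (hk _ _ p.2).2 m
      refine ⟨((t, x), p), ?_⟩
      rw [hd]
      have hc : (T'.diffs B (t, p)).2 = c := congrArg Prod.snd hp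
      refine Prod.ext ?_ hc
      simp only [hm, sub_add_cancel, act_neg_act]
  · rintro ⟨⟨t, b, q⟩, a, ε⟩ ⟨⟨u, b', q'⟩, a', ε'⟩ e
    have e' := congrArg (Prod.map π id) e
    rw [hpt', hpt'] at e'
    have e'' := hB.points_injective e'
    simp only [Prod.mk.injEq] at e''
    obtain ⟨rfl, rfl, rfl⟩ := e''
    rw [hpt, hpt] at e
    have e1 := hκ (add_right_cancel (congrArg Prod.fst e))
    have e2 := (hk' b a).1 (a₁ := (q, ε)) (a₂ := (q', ε')) e1
    obtain ⟨rfl, rfl⟩ := Prod.mk.inj e2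
    rfl
  · ext ⟨p, c⟩
    constructor
    · rintro ⟨⟨⟨t, b, q⟩, a, ε⟩, e⟩
      have e' := congrArg (fun z => (Prod.map π id z).1) e
      rw [hpt'] at e'
      have hm : points j' B (t, a, b) ∈ {p | p.1 ∉ H} := hB.range_points ▸ ⟨_, rfl⟩
      intro ha
      exact hm (e' ▸ ha)
    · intro hp
      have hm : (π p, c) ∈ Set.range (points j' B) := hB.range_points ▸ hp
      obtain ⟨⟨t, a, b⟩, hta⟩ := hm
      obtain ⟨m, hm⟩ := hker (p - (s (B t a).1 + cond b (s j') 0)) (by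
        have h1 : (B t a).1 + cond b j' 0 = π p := congrArg Prod.fst hta
        rw [map_sub, ← h1, map_add, hs]
        cases b <;> simp [hs _])
      obtain ⟨⟨q, ε⟩, rfl⟩ := (hk' b a).2 m
      refine ⟨((t, (b, q)), a, ε), ?_⟩
      rw [hpt]
      have hc : (points j' B (t, a, b)).2 = c := congrArg Prod.snd hta
      refine Prod.ext ?_ hc
      simp only [hm, sub_add_cancel]

/-! ### Multiplication by finite fields -/

/-- The fourth roots of unity, indexed by `ℤ/4`. -/
def fourthRoot {F : Type} [Field F] (r : F) (l : ZMod 4) : F := r ^ l.val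

/-- The signs, indexed by `ℤ/2`. -/
def signOf (F : Type) [Field F] (l : ZMod 2) : F := (-1) ^ l.val

/-- Families of triples that multiply by every finite field with a square root `r` of `-1`. Triple
`i` has the multipliers `r ^ k i * (1, -1, r)`, which are the powers of `r` with exponents
`k i + (0, 2, 1)`. The quotients of the first two elements lie in `A`, the other quotients outside
`A`. The `3 × 3` array lists the exponents, relative to `k i`, of the differences of multipliers as
powers of `r`, after division by `2` for the quotients in `A` and by `r - 1` for the others. Each
point of `A ⋊ ℤ/3` occurs with each power of `r` exactly once in the triples and their translates by
`j`, and each quotient occurs with each power of `r` exactly once. -/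
def FourthRootFamily (T : Twist A) (j : A) : Prop :=
  ∃ (ι : Type) (B : ι → Fin 3 → A × ZMod 3) (k : ι → ZMod 4),
    (Function.Bijective fun x : ι × Fin 3 × Bool =>
      (points j B x, k x.1 + (![0, 2, 1] : Fin 3 → ZMod 4) x.2.1)) ∧
    (Function.Bijective fun x : ι × Pairs => (T.diffs B x,
      k x.1 + (![![0, 2, 0], ![0, 0, 3], ![2, 1, 0]] : Fin 3 → Fin 3 → ZMod 4) x.2.1.1 x.2.1.2)) ∧
    ∀ i, (B i 0).2 = (B i 1).2 ∧ (B i 2).2 ≠ (B i 0).2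

/-- Families of triples that multiply by every finite field with `4 n + 3 > 3` elements. Triple `i`
has the multipliers `± (1, -1, t)` or `± (1, -1, -t)`, where `t` and `1 - t ^ 2` are squares: the
sign of the first is given by `k i` and that of `t` by `m i`. The quotients of the first two
elements lie in `A`, the other quotients outside `A`. The `3 × 3` array lists the signs, relative to
`k i`, of the differences of multipliers up to squares, after division by `2` for the quotients in
`A` and by `t - 1` for the others. Each point of `A ⋊ ℤ/3` occurs with each sign exactly once in the
triples and their translates by `j`, and each quotient occurs with each sign exactly once. -/
def SignFamily (T : Twist A) (j : A) : Prop :=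
  ∃ (ι : Type) (B : ι → Fin 3 → A × ZMod 3) (k m : ι → ZMod 2),
    (Function.Bijective fun x : ι × Fin 3 × Bool =>
      (points j B x, (![k x.1, k x.1 + 1, m x.1] : Fin 3 → ZMod 2) x.2.1)) ∧
    (Function.Bijective fun x : ι × Pairs => (T.diffs B x,
      k x.1 + (![![0, 1, 0], ![0, 0, 1], ![1, 0, 0]] : Fin 3 → Fin 3 → ZMod 2) x.2.1.1 x.2.1.2)) ∧
    ∀ i, (B i 0).2 = (B i 1).2 ∧ (B i 2).2 ≠ (B i 0).2

lemma fourthRoot_zero {F : Type} [Field F] (r : F) : fourthRoot r 0 = 1 := pow_zero r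

lemma fourthRoot_one {F : Type} [Field F] (r : F) : fourthRoot r 1 = r := pow_one r

lemma fourthRoot_add {F : Type} [Field F] {r : F} (hr : r ^ 2 = -1) (l l' : ZMod 4) :
    fourthRoot r (l + l') = fourthRoot r l * fourthRoot r l' := by
  have h4 : r ^ 4 = 1 := by linear_combination (r ^ 2 - 1) * hr
  rw [fourthRoot, ZMod.val_add, ← pow_eq_pow_mod _ h4, pow_add]
  rfl

/-- The cosets of the fourth roots of unity have a system of representatives. -/
lemma exists_transversal {F : Type} [Field F] (h2 : (2 : F) ≠ 0) {r : F} (hr : r ^ 2 = -1) :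
    ∃ X : Set F, (∀ z : F, z ≠ 0 → ∃! y : ZMod 4 × F, y.2 ∈ X ∧ fourthRoot r y.1 * y.2 = z) ∧
      ∀ l, ∀ x ∈ X, fourthRoot r l * x ≠ 0 := by
  have hr0 : r ≠ 0 := by rintro rfl; norm_num at hr
  have hv : ∀ l, fourthRoot r l ≠ 0 := fun l => pow_ne_zero _ hr0
  have h1 : ∀ l, fourthRoot r l = 1 → l = 0 := by
    have hm : (-1 : F) ≠ 1 := fun h => h2 (by linear_combination -h)
    have hr1 : r ≠ 1 := by rintro rfl; exact hm (by rw [← hr, one_pow])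
    have hr3 : r ^ 3 ≠ 1 := fun h => h2 (by
      have : r = -1 := by linear_combination r * hr - h
      rw [this] at hr
      linear_combination hr)
    intro l hl
    fin_cases l
    · rfl
    · exact (hr1 (by simpa [fourthRoot] using (pow_one r).symm.trans hl)).elim
    · exact (hm (hr.symm.trans hl)).elim
    · exact (hr3 hl).elim
  -- the representatives are chosen with `Quotient.out`
  let S : Setoid F :=
    { r := fun x y => ∃ l, fourthRoot r l * x = y
      iseqv :=
        { refl := fun x => ⟨0, by rw [fourthRoot_zero, one_mul]⟩
          symm := by
            rintro x _ ⟨l, rfl⟩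
            exact ⟨-l, by
              rw [← mul_assoc, ← fourthRoot_add hr, neg_add_cancel, fourthRoot_zero, one_mul]⟩
          trans := by
            rintro x _ _ ⟨l, rfl⟩ ⟨l', rfl⟩
            exact ⟨l' + l, by rw [fourthRoot_add hr, mul_assoc]⟩ } }
  refine ⟨{x | x ≠ 0 ∧ (Quotient.mk S x).out = x}, ?_, fun l x hx => mul_ne_zero (hv l) hx.1⟩
  intro z hz
  obtain ⟨l, hl⟩ : ∃ l, fourthRoot r l * (Quotient.mk S z).out = z :=
    Quotient.exact (Quotient.out_eq (Quotient.mk S z))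
  have hne : (Quotient.mk S z).out ≠ 0 := fun h => hz (by rw [← hl, h, mul_zero])
  refine ⟨(l, (Quotient.mk S z).out), ⟨⟨hne, by rw [Quotient.out_eq]⟩, hl⟩, ?_⟩
  rintro ⟨l', x⟩ ⟨⟨hx0, hx⟩, hl'⟩
  replace hl' : fourthRoot r l' * x = z := hl'
  replace hx : (Quotient.mk S x).out = x := hx
  have hxz : Quotient.mk S x = Quotient.mk S z := Quotient.sound ⟨l', hl'⟩
  have hx' : x = (Quotient.mk S z).out := by rw [← hxz]; exact hx.symm
  refine Prod.ext ?_ hx'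
  have : fourthRoot r (l' - l) = 1 := by
    have e : fourthRoot r l' = fourthRoot r l := by
      apply mul_right_cancel₀ hne
      rw [hl, ← hx', hl']
    rw [sub_eq_add_neg, fourthRoot_add hr, e, ← fourthRoot_add hr, add_neg_cancel,
      fourthRoot_zero]
  exact sub_eq_zero.1 (h1 _ this)

lemma FourthRootFamily.relProd (h : T.FourthRootFamily j) {F : Type} [Field F] (h2 : (2 : F) ≠ 0)
    {r : F} (hr : r ^ 2 = -1) : T.RelProd j F := by
  obtain ⟨ι, B, k, hp, hd, hB⟩ := h
  obtain ⟨X, hX, hX0⟩ := exists_transversal h2 hr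
  have hr1 : r - 1 ≠ 0 := fun h => h2 (by
    have : r = 1 := sub_eq_zero.1 h
    rw [this] at hr
    linear_combination hr)
  have v1 : ∀ l, fourthRoot r (l + 1) = r * fourthRoot r l := fun l => by
    rw [fourthRoot_add hr, fourthRoot_one, mul_comm]
  have v2 : ∀ l, fourthRoot r (l + 2) = - fourthRoot r l := fun l => by
    rw [show l + 2 = l + 1 + 1 by ring, v1, v1]
    linear_combination fourthRoot r l * hr
  have v3 : ∀ l, fourthRoot r (l + 3) = - r * fourthRoot r l := fun l => by
    rw [show l + 3 = l + 2 + 1 by ring, v1, v2]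
    ring
  classical
  refine relProd_of_labels (ℓ := fun i a => k i + (![0, 2, 1] : Fin 3 → ZMod 4) a)
    (u := fun i a => fourthRoot r (k i + (![0, 2, 1] : Fin 3 → ZMod 4) a))
    (δ := fun i x => k i +
      (![![0, 2, 0], ![0, 0, 3], ![2, 1, 0]] : Fin 3 → Fin 3 → ZMod 4) x.1.1 x.1.2)
    (c := fun g => if g.2 = 0 then 2 else r - 1) hp hd hX hX0 ?_ ?_ ?_
  · intro g
    show (if g.2 = 0 then (2 : F) else r - 1) ≠ 0
    split_ifs
    · exact h2
    · exact hr1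
  · exact fun i a => ⟨1, one_ne_zero, by simp, (mul_one _).symm⟩
  · rintro i ⟨⟨a, b⟩, hab⟩
    refine ⟨1, one_ne_zero, by simp, ?_⟩
    obtain ⟨e1, e2⟩ := hB i
    have e3 : (B i 2).2 ≠ (B i 1).2 := e1 ▸ e2
    fin_cases a <;> fin_cases b <;>
      first
      | exact absurd rfl hab
      | simp [diffs, diff, sub_eq_zero, e1, e3, e3.symm, v1, v2, v3]
        first
        | ring1
        | linear_combination fourthRoot r (k i) * hr
        | linear_combination -fourthRoot r (k i) * hr

lemma signOf_add {F : Type} [Field F] (l l' : ZMod 2) :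
    signOf F (l + l') = signOf F l * signOf F l' := by
  rw [signOf, ZMod.val_add, ← pow_eq_pow_mod _ (by norm_num), pow_add]
  rfl

lemma exists_ne_zero_one_neg_one {F : Type} [Field F] [Fintype F] (hcard : 3 < Fintype.card F) :
    ∃ ν : F, ν ≠ 0 ∧ ν ≠ 1 ∧ ν ≠ -1 := by
  classical
  obtain ⟨ν, hν⟩ : ∃ ν : F, ν ∉ ({0, 1, -1} : Finset F) := by
    by_contra! hc
    have := Finset.card_le_card (fun x _ => hc x : Finset.univ ⊆ ({0, 1, -1} : Finset F))
    have h3 := Finset.card_le_three (a := (0 : F)) (b := 1) (c := -1)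
    rw [Finset.card_univ] at this
    omega
  simp only [Finset.mem_insert, Finset.mem_singleton, not_or] at hν
  exact ⟨ν, hν⟩

/-- In a finite field with `4 n + 3 > 3` elements there is a square `t ≠ 0, ±1` such that
`1 - t ^ 2` is a square. -/
lemma exists_square {F : Type} [Field F] [Fintype F] (hF : ¬ IsSquare (-1 : F))
    (h : ∀ z : F, IsSquare z ∨ IsSquare (-z)) (hcard : 3 < Fintype.card F) :
    ∃ t : F, t ≠ 0 ∧ t ≠ 1 ∧ t ≠ -1 ∧ IsSquare t ∧ IsSquare (1 - t ^ 2) := by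
  classical
  have h2 : (2 : F) ≠ 0 := fun h => hF ⟨1, by linear_combination -h⟩
  obtain ⟨ν, ν0, ν1, ν2⟩ := exists_ne_zero_one_neg_one hcard
  -- for `t = ± (ν ^ 2 - 1) / (ν ^ 2 + 1)` the value of `1 - t ^ 2` is a square
  have hd : ν ^ 2 + 1 ≠ 0 := fun h => hF ⟨ν, by linear_combination -h⟩
  have hn : ν ^ 2 - 1 ≠ 0 := fun h => by
    have : (ν - 1) * (ν + 1) = 0 := by linear_combination h
    rcases mul_eq_zero.1 this with h | h
    · exact ν1 (sub_eq_zero.1 h)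
    · exact ν2 (eq_neg_of_add_eq_zero_left h)
  have key : ∀ t : F, (t = (ν ^ 2 - 1) / (ν ^ 2 + 1) ∨ t = -((ν ^ 2 - 1) / (ν ^ 2 + 1))) →
      IsSquare t → ∃ t : F, t ≠ 0 ∧ t ≠ 1 ∧ t ≠ -1 ∧ IsSquare t ∧ IsSquare (1 - t ^ 2) := by
    intro t ht hs
    have ht2 : t ^ 2 = ((ν ^ 2 - 1) / (ν ^ 2 + 1)) ^ 2 := by
      rcases ht with rfl | rfl
      · rfl
      · exact neg_sq _
    have h1 : 1 - t ^ 2 = (2 * ν / (ν ^ 2 + 1)) ^ 2 := by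
      rw [ht2]
      field_simp
      ring
    have h0 : 1 - t ^ 2 ≠ 0 := by
      rw [h1]
      exact pow_ne_zero _ (div_ne_zero (mul_ne_zero h2 ν0) hd)
    refine ⟨t, ?_, ?_, ?_, hs, ⟨_, h1.trans (sq _)⟩⟩
    · rintro rfl
      exact pow_ne_zero 2 (div_ne_zero hn hd) (by rw [← ht2]; ring)
    · rintro rfl
      exact h0 (by ring)
    · rintro rfl
      exact h0 (by ring)
  rcases h ((ν ^ 2 - 1) / (ν ^ 2 + 1)) with h | h
  · exact key _ (Or.inl rfl) h
  · exact key _ (Or.inr rfl) h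

lemma SignFamily.relProd (h : T.SignFamily j) {F : Type} [Field F] [Fintype F]
    (hF : Fintype.card F % 4 = 3) (hcard : 3 < Fintype.card F) : T.RelProd j F := by
  classical
  obtain ⟨ι, B, k, m, hp, hd, hB⟩ := h
  have hm1 : ¬ IsSquare (-1 : F) := fun h => FiniteField.isSquare_neg_one_iff.1 h hF
  have h2 : (2 : F) ≠ 0 := fun h => hm1 ⟨1, by linear_combination -h⟩
  have hchar : ringChar F ≠ 2 := fun h => by
    apply h2
    have := ringChar.Nat.cast_ringChar (R := F)
    rw [h] at this
    exact_mod_cast this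
  have hsq : ∀ z : F, IsSquare z ∨ IsSquare (-z) := by
    intro z
    by_cases hz : z = 0
    · exact Or.inl (hz ▸ ⟨0, by simp⟩)
    by_contra! hc
    have e1 := quadraticChar_neg_one_iff_not_isSquare.2 hc.1
    have e2 := quadraticChar_neg_one_iff_not_isSquare.2 hc.2
    have e3 := quadraticChar_neg_one_iff_not_isSquare.2 hm1
    rw [neg_eq_neg_one_mul, map_mul, e1, e3] at e2
    norm_num at e2
  have hsq' : ∀ z : F, z ≠ 0 → ¬ (IsSquare z ∧ IsSquare (-z)) := by
    rintro z hz ⟨⟨x, hx⟩, ⟨y, hy⟩⟩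
    have hx0 : x ≠ 0 := by rintro rfl; exact hz (by simpa using hx)
    refine hm1 ⟨y / x, ?_⟩
    field_simp
    linear_combination hy + hx
  obtain ⟨t, t0, t1, t2, ⟨a, ha⟩, ⟨b, hb⟩⟩ := exists_square hm1 hsq hcard
  let X : Set F := {x | x ≠ 0 ∧ IsSquare x}
  have v0 : signOf F 0 = 1 := pow_zero _
  have v1 : ∀ l, signOf F (l + 1) = - signOf F l := fun l => by
    rw [signOf_add, show signOf F 1 = -1 from pow_one _, mul_neg_one]
  have hv : ∀ l, signOf F l = 1 ∨ signOf F l = -1 := fun l => neg_one_pow_eq_or F l.val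
  have hX0 : ∀ l, ∀ x ∈ X, signOf F l * x ≠ 0 := fun l x hx =>
    mul_ne_zero (pow_ne_zero _ (neg_ne_zero.2 one_ne_zero)) hx.1
  have hX : ∀ z : F, z ≠ 0 → ∃! y : ZMod 2 × F, y.2 ∈ X ∧ signOf F y.1 * y.2 = z := by
    intro z hz
    have e1 : ∀ l : ZMod 2, l = 0 ∨ l = 1 := by decide
    have v1' : signOf F 1 = -1 := pow_one _
    rcases hsq z with h | h
    · refine ⟨(0, z), ⟨⟨hz, h⟩, by simp [v0]⟩, ?_⟩
      rintro ⟨l, x⟩ ⟨⟨hx, hx'⟩, hl⟩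
      rcases e1 l with rfl | rfl
      · simpa [v0] using hl
      · have : z = -x := by simpa [v1'] using hl.symm
        exact (hsq' x hx ⟨hx', this ▸ h⟩).elim
    · refine ⟨(1, -z), ⟨⟨neg_ne_zero.2 hz, h⟩, by simp [v1']⟩, ?_⟩
      rintro ⟨l, x⟩ ⟨⟨hx, hx'⟩, hl⟩
      rcases e1 l with rfl | rfl
      · have : z = x := by simpa [v0] using hl.symm
        exact (hsq' x hx ⟨hx', this ▸ h⟩).elim
      · have : z = -x := by simpa [v1'] using hl.symm
        simp [this]
  have hmul : ∀ s : F, s ≠ 0 → IsSquare s → ∀ x, s * x ∈ X ↔ x ∈ X := by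
    rintro s hs ⟨y, rfl⟩ x
    have hy : y ≠ 0 := left_ne_zero_of_mul hs
    constructor
    · rintro ⟨h, z, hz⟩
      exact ⟨right_ne_zero_of_mul h, z / y, by field_simp; linear_combination hz⟩
    · rintro ⟨h, z, rfl⟩
      exact ⟨mul_ne_zero hs h, y * z, by ring⟩
  have t1' : 1 - t ≠ 0 := fun h => t1 (sub_eq_zero.1 h).symm
  have t2' : 1 + t ≠ 0 := fun h => t2 (eq_neg_of_add_eq_zero_right h)
  have hs0 : (1 + t) / (1 - t) ≠ 0 := div_ne_zero t2' t1'
  -- the factor by which `t - 1` and `-(1 + t)` differ is the square `(1 - t ^ 2) / (1 - t) ^ 2`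
  have hs : IsSquare ((1 + t) / (1 - t)) := ⟨b / (1 - t), by
    field_simp
    linear_combination hb⟩
  have e1 : (1 : F) ≠ 0 ∧ ∀ x, 1 * x ∈ X ↔ x ∈ X := ⟨one_ne_zero, by simp⟩
  have e2 : (1 + t) / (1 - t) ≠ 0 ∧ ∀ x, (1 + t) / (1 - t) * x ∈ X ↔ x ∈ X :=
    ⟨hs0, hmul _ hs0 hs⟩
  refine relProd_of_labels (ℓ := fun i a => (![k i, k i + 1, m i] : Fin 3 → ZMod 2) a)
    (u := fun i => ![signOf F (k i), - signOf F (k i), signOf F (m i) * t])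
    (δ := fun i x => k i +
      (![![0, 1, 0], ![0, 0, 1], ![1, 0, 0]] : Fin 3 → Fin 3 → ZMod 2) x.1.1 x.1.2)
    (c := fun g => if g.2 = 0 then 2 else t - 1) hp hd hX hX0 ?_ ?_ ?_
  · intro g
    show (if g.2 = 0 then (2 : F) else t - 1) ≠ 0
    split_ifs
    · exact h2
    · exact sub_ne_zero.2 t1
  · intro i a
    fin_cases a
    · exact ⟨1, e1.1, e1.2, (mul_one _).symm⟩
    · exact ⟨1, e1.1, e1.2, by simp [v1]⟩
    · exact ⟨t, t0, hmul t t0 ⟨a, ha⟩, rfl⟩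
  · rintro i ⟨⟨a, b⟩, hab⟩
    obtain ⟨c1, c2⟩ := hB i
    have c3 : (B i 2).2 ≠ (B i 1).2 := c1 ▸ c2
    by_cases hs : signOf F (m i) = signOf F (k i)
    · fin_cases a <;> fin_cases b <;>
        first
        | exact absurd rfl hab
        | refine ⟨1, e1.1, e1.2, ?_⟩
          simp [diffs, diff, sub_eq_zero, c1, c3, c3.symm, v1, hs]
          ring1
        | refine ⟨_, e2.1, e2.2, ?_⟩
          simp [diffs, diff, sub_eq_zero, c3, c3.symm, v1, hs]
          field_simp
          ring1
    · replace hs : signOf F (m i) = - signOf F (k i) := by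
        rcases hv (m i) with h | h <;> rcases hv (k i) with h' | h' <;> rw [h, h'] at hs ⊢ <;>
          simp at hs ⊢
      fin_cases a <;> fin_cases b <;>
        first
        | exact absurd rfl hab
        | refine ⟨1, e1.1, e1.2, ?_⟩
          simp [diffs, diff, sub_eq_zero, c1, c3, c3.symm, v1, hs]
          ring1
        | refine ⟨_, e2.1, e2.2, ?_⟩
          simp [diffs, diff, sub_eq_zero, c1, c3, c3.symm, v1, hs]
          field_simp
          ring1

end Twist

/-! ### Verification of finite families -/

/-- An explicit numbering of a finite type. -/
class Coding (α : Type) where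
  size : ℕ
  code : α → ℕ
  decode : ℕ → α
  code_lt : ∀ a, code a < size
  decode_code : ∀ a, decode (code a) = a

namespace Coding

instance (n : ℕ) [NeZero n] : Coding (ZMod n) where
  size := n
  code := ZMod.val
  decode k := k
  code_lt := ZMod.val_lt
  decode_code := ZMod.natCast_zmod_val

instance {α β : Type} [Coding α] [Coding β] : Coding (α × β) where
  size := size α * size β
  code x := code x.1 * size β + code x.2
  decode k := (decode (k / size β), decode (k % size β))
  code_lt x := by
    have h1 := code_lt x.1
    have h2 := code_lt x.2
    nlinarith
  decode_code x := by
    have h2 := code_lt x.2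
    have hp : 0 < size β := by omega
    rw [mul_comm, Nat.mul_add_div hp, Nat.mul_add_mod, Nat.div_eq_of_lt h2, Nat.mod_eq_of_lt h2,
      add_zero, decode_code, decode_code]

/-- The natural number with binary digits `1` at the positions in `l`. -/
def mask (l : List ℕ) : ℕ := l.foldr (fun x m => 2 ^ x ||| m) 0

lemma mem_of_testBit_mask {l : List ℕ} {n : ℕ} (h : (mask l).testBit n) : n ∈ l := by
  induction l with
  | nil => simp [mask] at h
  | cons x l ih =>
    simp only [mask, List.foldr_cons, Nat.testBit_or, Bool.or_eq_true, Nat.testBit_two_pow,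
      decide_eq_true_eq] at h
    rcases h with rfl | h
    · exact List.mem_cons_self
    · exact List.mem_cons_of_mem _ (ih h)

/-- The list `l` contains the codes of the elements of `D`, each exactly once, and nothing else. -/
def Exact {α : Type} [Coding α] (l : List ℕ) (D : Set α) [DecidablePred (· ∈ D)] : Prop :=
  (l ++ (List.range (size α)).filter fun n => (decode n : α) ∉ D).length = size α ∧
    mask (l ++ (List.range (size α)).filter fun n => (decode n : α) ∉ D) = 2 ^ size α - 1

instance {α : Type} [Coding α] (l : List ℕ) (D : Set α) [DecidablePred (· ∈ D)] :
    Decidable (Exact l D) := instDecidableAnd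

lemma Exact.nodup_and_mem {α : Type} [Coding α] {l : List ℕ} {D : Set α} [DecidablePred (· ∈ D)]
    (h : Exact l D) : l.Nodup ∧ ∀ a : α, code a ∈ l ↔ a ∈ D := by
  obtain ⟨h1, h2⟩ := h
  set l' := (List.range (size α)).filter fun n => (decode n : α) ∉ D with hl'
  have hmem : ∀ n < size α, n ∈ l ++ l' := fun n hn => mem_of_testBit_mask (by
    rw [h2, Nat.testBit_two_pow_sub_one]
    simpa using hn)
  have hnd : (l ++ l').Nodup := by
    rw [← Multiset.coe_nodup, ← Multiset.toFinset_card_eq_card_iff_nodup]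
    refine le_antisymm (Multiset.toFinset_card_le _) ?_
    rw [Multiset.coe_card, h1, ← Finset.card_range (size α)]
    exact Finset.card_le_card fun n hn => by simpa using hmem n (Finset.mem_range.1 hn)
  have hmem' : ∀ a : α, code a ∈ l' ↔ a ∉ D := fun a => by
    simp [hl', code_lt, decode_code]
  rw [List.nodup_append'] at hnd
  refine ⟨hnd.1, fun a => ⟨fun ha => ?_, fun ha => ?_⟩⟩
  · by_contra hD
    exact hnd.2.2 ha ((hmem' a).2 hD)
  · rcases List.mem_append.1 (hmem _ (code_lt a)) with h | h
    · exact h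
    · exact absurd ha ((hmem' a).1 h)

/-- The codes of the values of `f` at the elements of the lists `l` and `ks`. -/
def codes {α β κ : Type} [Coding α] (l : List β) (ks : List κ) (f : β → κ → α) : List ℕ :=
  l.flatMap fun b => ks.map fun k => code (f b k)

/-- A function of an element of the list `l` and of an element of the list `ks` of all elements of
`κ` is injective with range `D` if the list of its values is exactly `D`. -/
lemma Exact.injective_and_range {α β κ : Type} [Coding α] {l : List β} {f : β → κ → α}
    {ks : List κ} (hks : ks.Nodup) (hk : ∀ k, k ∈ ks) {D : Set α} [DecidablePred (· ∈ D)]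
    (h : Exact (codes l ks f) D) :
    (Function.Injective fun x : Fin l.length × κ => f l[x.1] x.2) ∧
      (Set.range fun x : Fin l.length × κ => f l[x.1] x.2) = D := by
  classical
  obtain ⟨h1, h2⟩ := h.nodup_and_mem
  let _ : Fintype κ := ⟨ks.toFinset, fun k => List.mem_toFinset.2 (hk k)⟩
  have hcard : Fintype.card κ = ks.length := List.toFinset_card_of_nodup hks
  have hmem : ∀ n, n ∈ codes l ks f ↔
      ∃ x : Fin l.length × κ, code (f l[x.1] x.2) = n := by
    intro n
    simp only [codes, List.mem_flatMap, List.mem_map]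
    constructor
    · rintro ⟨b, hb, k, -, rfl⟩
      obtain ⟨i, hi, rfl⟩ := List.mem_iff_getElem.1 hb
      exact ⟨(⟨i, hi⟩, k), rfl⟩
    · rintro ⟨x, rfl⟩
      exact ⟨_, List.getElem_mem _, _, hk _, rfl⟩
  constructor
  · have : Set.InjOn (fun x : Fin l.length × κ => code (f l[x.1] x.2))
        (Finset.univ : Finset (Fin l.length × κ)) := by
      rw [← Finset.card_image_iff]
      have e : Finset.univ.image (fun x : Fin l.length × κ => code (f l[x.1] x.2)) =
          (codes l ks f).toFinset := by
        ext n
        rw [List.mem_toFinset, hmem]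
        simp
      rw [e, List.toFinset_card_of_nodup h1, Finset.card_univ, Fintype.card_prod, hcard,
        Fintype.card_fin]
      simp [codes, List.length_flatMap]
    intro x y hxy
    exact this (Finset.mem_coe.2 (Finset.mem_univ _)) (Finset.mem_coe.2 (Finset.mem_univ _))
      (congrArg code hxy)
  · ext a
    rw [← h2, hmem]
    constructor
    · rintro ⟨x, rfl⟩
      exact ⟨x, rfl⟩
    · rintro ⟨x, hx⟩
      refine ⟨x, ?_⟩
      rw [← decode_code a, ← hx, decode_code]

end Coding

namespace Twist

open Coding

/-- All ordered pairs of distinct positions. -/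
def allPairs : List Pairs :=
  [⟨(0, 1), by decide⟩, ⟨(0, 2), by decide⟩, ⟨(1, 0), by decide⟩, ⟨(1, 2), by decide⟩,
    ⟨(2, 0), by decide⟩, ⟨(2, 1), by decide⟩]

/-- All positions in a block and in its translate. -/
def allPositions : List (Fin 3 × Bool) :=
  [(0, false), (0, true), (1, false), (1, true), (2, false), (2, true)]

lemma nodup_allPairs : allPairs.Nodup := by decide

lemma mem_allPairs : ∀ k, k ∈ allPairs := by decide

lemma nodup_allPositions : allPositions.Nodup := by decide

lemma mem_allPositions : ∀ k, k ∈ allPositions := by decide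

variable {A : Type} [AddCommGroup A] [Coding A]

/-- The triple of elements with the given codes. -/
def triple (A : Type) [Coding A] (x y z : ℕ) : Fin 3 → A × ZMod 3 := ![decode x, decode y, decode z]

variable {T : Twist A} {j : A}

lemma hasCover_of_exact {l : List (ℕ × ℕ × ℕ)} {D S : Set (A × ZMod 3)}
    [DecidablePred (· ∈ D)] [DecidablePred (· ∈ S)]
    (hD : Exact (codes l allPairs fun b k =>
      T.diff (triple A b.1 b.2.1 b.2.2 k.1.1) (triple A b.1 b.2.1 b.2.2 k.1.2)) D)
    (hS : Exact (codes l allPositions fun b k => shift j (triple A b.1 b.2.1 b.2.2 k.1) k.2) S) :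
    T.HasCover j D S := by
  have h1 := hD.injective_and_range nodup_allPairs mem_allPairs
  have h2 := hS.injective_and_range nodup_allPositions mem_allPositions
  exact ⟨Fin l.length, fun i => triple A l[i].1 l[i].2.1 l[i].2.2, h1.1, h1.2, h2.1, h2.2⟩

lemma fourthRootFamily_of_exact {l : List (ℕ × ℕ × ℕ × ℕ)}
    (hS : Exact (α := (A × ZMod 3) × ZMod 4) (codes l allPositions fun b k =>
      (shift j (triple A b.1 b.2.1 b.2.2.1 k.1) k.2,
        (b.2.2.2 : ZMod 4) + (![0, 2, 1] : Fin 3 → ZMod 4) k.1)) Set.univ)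
    (hD : Exact (α := (A × ZMod 3) × ZMod 4) (codes l allPairs fun b k =>
      (T.diff (triple A b.1 b.2.1 b.2.2.1 k.1.1) (triple A b.1 b.2.1 b.2.2.1 k.1.2),
        (b.2.2.2 : ZMod 4) +
          (![![0, 2, 0], ![0, 0, 3], ![2, 1, 0]] : Fin 3 → Fin 3 → ZMod 4) k.1.1 k.1.2)) Set.univ)
    (hB : ∀ b ∈ l, (triple A b.1 b.2.1 b.2.2.1 0).2 = (triple A b.1 b.2.1 b.2.2.1 1).2 ∧
      (triple A b.1 b.2.1 b.2.2.1 2).2 ≠ (triple A b.1 b.2.1 b.2.2.1 0).2) :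
    T.FourthRootFamily j := by
  have h1 := hS.injective_and_range nodup_allPositions mem_allPositions
  have h2 := hD.injective_and_range nodup_allPairs mem_allPairs
  exact ⟨Fin l.length, fun i => triple A l[i].1 l[i].2.1 l[i].2.2.1, fun i => l[i].2.2.2,
    ⟨h1.1, Set.range_eq_univ.1 h1.2⟩, ⟨h2.1, Set.range_eq_univ.1 h2.2⟩,
    fun i => hB _ (List.getElem_mem _)⟩

lemma signFamily_of_exact {l : List (ℕ × ℕ × ℕ × ℕ × ℕ)}
    (hS : Exact (α := (A × ZMod 3) × ZMod 2) (codes l allPositions fun b k =>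
      (shift j (triple A b.1 b.2.1 b.2.2.1 k.1) k.2,
        (![(b.2.2.2.1 : ZMod 2), b.2.2.2.1 + 1, b.2.2.2.2] : Fin 3 → ZMod 2) k.1)) Set.univ)
    (hD : Exact (α := (A × ZMod 3) × ZMod 2) (codes l allPairs fun b k =>
      (T.diff (triple A b.1 b.2.1 b.2.2.1 k.1.1) (triple A b.1 b.2.1 b.2.2.1 k.1.2),
        (b.2.2.2.1 : ZMod 2) +
          (![![0, 1, 0], ![0, 0, 1], ![1, 0, 0]] : Fin 3 → Fin 3 → ZMod 2) k.1.1 k.1.2)) Set.univ)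
    (hB : ∀ b ∈ l, (triple A b.1 b.2.1 b.2.2.1 0).2 = (triple A b.1 b.2.1 b.2.2.1 1).2 ∧
      (triple A b.1 b.2.1 b.2.2.1 2).2 ≠ (triple A b.1 b.2.1 b.2.2.1 0).2) :
    T.SignFamily j := by
  have h1 := hS.injective_and_range nodup_allPositions mem_allPositions
  have h2 := hD.injective_and_range nodup_allPairs mem_allPairs
  exact ⟨Fin l.length, fun i => triple A l[i].1 l[i].2.1 l[i].2.2.1, fun i => l[i].2.2.2.1,
    fun i => l[i].2.2.2.2,
    ⟨h1.1, Set.range_eq_univ.1 h1.2⟩, ⟨h2.1, Set.range_eq_univ.1 h2.2⟩,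
    fun i => hB _ (List.getElem_mem _)⟩

/-! ### The basic families

The triples are listed by the codes of their elements. In the families that multiply by fields, the
codes are followed by the labels of the multipliers. -/

/-- The action of `ℤ/3` on `M × M` through the matrix of order three with rows `(0, -1)` and
`(1, -1)`. -/
def rotation (M : Type) [AddCommGroup M] : Twist (M × M) where
  act c :=
    { toFun := fun x =>
        if c = 0 then x else if c = 1 then (-x.2, x.1 - x.2) else (x.2 - x.1, -x.1)
      map_zero' := by split_ifs <;> simp
      map_add' := fun x y => by
        split_ifs
        · rfl
        all_goals ext <;> simp only [Prod.fst_add, Prod.snd_add] <;> abel }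
  act_zero _ := rfl
  act_add c d x := by
    have h1 : (1 : ZMod 3) + 1 = 2 := rfl
    have h2 : (1 : ZMod 3) + 2 = 0 := rfl
    have h3 : (2 : ZMod 3) + 1 = 0 := rfl
    have h4 : (2 : ZMod 3) + 2 = 1 := rfl
    have h5 : (2 : ZMod 3) ≠ 0 := by decide
    have h6 : (2 : ZMod 3) ≠ 1 := by decide
    have hc : ∀ c : ZMod 3, c = 0 ∨ c = 1 ∨ c = 2 := by decide
    rcases hc c with rfl | rfl | rfl <;> rcases hc d with rfl | rfl | rfl <;>
      simp [h1, h2, h3, h4, h5, h6]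
    all_goals abel

instance (n : ℕ) [NeZero n] : DecidablePred (Even : ZMod n → Prop) := fun a =>
  inferInstanceAs (Decidable (∃ r, a = r + r))

lemma complete_rotation2_prod3 : Complete ((rotation (ZMod 2)).prod (ZMod 3)) ((1, 0), 0) :=
  hasCover_of_exact (l := [
    (9, 12, 32), (5, 7, 24), (13, 17, 34), (8, 22, 29), (3, 15, 28)])
    (by decide +kernel) (by decide +kernel)

lemma complete_rotation2_prod9 : Complete ((rotation (ZMod 2)).prod (ZMod 3 × ZMod 3))
    ((1, 0), 0) :=
  hasCover_of_exact (l := [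
    (3, 39, 96), (4, 17, 102), (6, 34, 104), (5, 12, 29), (7, 14, 87), (8, 65, 84), (10, 21, 89),
    (49, 53, 70), (52, 28, 98), (43, 63, 24), (31, 40, 80), (25, 100, 45), (20, 23, 86),
    (19, 105, 38), (13, 18, 76), (36, 41, 47), (15, 37, 81)])
    (by decide +kernel) (by decide +kernel)

lemma complete_rotation4 : Complete (rotation (ZMod 4)) (2, 0) :=
  hasCover_of_exact (l := [
    (3, 8, 40), (7, 11, 36), (9, 21, 30), (17, 29, 10), (18, 22, 43), (23, 20, 28), (14, 37, 15)])
    (by decide +kernel) (by decide +kernel)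

lemma relCover_rotation4 : RelCover (rotation (ZMod 4)) (2, 0) {x | Even x.1 ∧ Even x.2} :=
  hasCover_of_exact (l := [
    (34, 16, 14), (9, 42, 23), (20, 5, 21), (11, 41, 13), (12, 15, 28), (22, 43, 3)])
    (by decide +kernel) (by decide +kernel)

lemma relCover_rotation4_prod3 : RelCover ((rotation (ZMod 4)).prod (ZMod 3))
    ((2, 0), 0) {x | Even x.1.1 ∧ Even x.1.2} :=
  hasCover_of_exact (l := [
    (39, 46, 30), (13, 57, 136), (42, 50, 15), (60, 52, 99), (35, 131, 45), (53, 12, 113),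
    (32, 70, 134), (43, 28, 138), (16, 112, 71), (11, 121, 37), (68, 105, 127), (56, 9, 141),
    (17, 51, 116), (34, 139, 58), (48, 38, 10), (54, 63, 31), (61, 65, 86), (36, 47, 101)])
    (by decide +kernel) (by decide +kernel)

lemma relCover_rotation8 : RelCover (rotation (ZMod 8)) (4, 0) {x | Even x.1 ∧ Even x.2} :=
  hasCover_of_exact (l := [
    (30, 34, 118), (32, 172, 16), (91, 147, 185), (25, 107, 141), (95, 119, 139), (31, 3, 87),
    (73, 15, 124), (36, 69, 190), (63, 136, 181), (79, 82, 100), (47, 21, 168), (38, 105, 123),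
    (10, 125, 24), (37, 41, 5), (52, 140, 179), (80, 77, 167), (17, 86, 33), (75, 74, 155),
    (65, 135, 90), (93, 78, 58), (64, 180, 81), (35, 53, 138), (46, 188, 166), (88, 122, 153)])
    (by decide +kernel) (by decide +kernel)

lemma fourthRootFamily_rotation2_prod3 : FourthRootFamily ((rotation (ZMod 2)).prod (ZMod 3))
    ((1, 0), 0) :=
  fourthRootFamily_of_exact (l := [
    (7, 25, 0, 0), (3, 15, 14, 0), (1, 16, 24, 0), (10, 34, 27, 2), (1, 13, 5, 3),
    (16, 16, 18, 3), (17, 5, 22, 3), (0, 30, 17, 3), (11, 26, 6, 3), (15, 24, 23, 1),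
    (2, 20, 12, 2), (2, 5, 24, 1), (11, 35, 9, 0), (10, 25, 0, 1), (4, 10, 20, 2), (1, 28, 21, 1),
    (3, 21, 1, 1), (11, 14, 13, 2), (13, 13, 35, 0), (14, 8, 33, 2), (9, 15, 26, 2),
    (12, 30, 4, 0), (14, 29, 27, 3), (7, 4, 8, 1)])
    (by decide +kernel) (by decide +kernel) (by decide +kernel)

lemma fourthRootFamily_rotation2_prod9 :
    FourthRootFamily ((rotation (ZMod 2)).prod (ZMod 3 × ZMod 3)) ((1, 0), 0) :=
  fourthRootFamily_of_exact (l := [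
    (27, 27, 29, 0), (30, 33, 47, 0), (33, 30, 38, 0), (36, 45, 32, 0), (39, 51, 50, 0),
    (42, 48, 41, 0), (45, 36, 35, 0), (48, 42, 53, 0), (51, 39, 44, 0), (28, 55, 2, 3),
    (31, 61, 20, 3), (34, 58, 11, 3), (37, 73, 5, 3), (40, 79, 23, 3), (43, 76, 14, 3),
    (46, 64, 8, 3), (49, 70, 26, 3), (52, 67, 17, 3), (27, 27, 55, 1), (30, 33, 73, 1),
    (33, 30, 64, 1), (36, 45, 58, 1), (39, 51, 76, 1), (42, 48, 67, 1), (45, 36, 61, 1),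
    (48, 42, 79, 1), (51, 39, 70, 1), (0, 54, 2, 1), (3, 60, 20, 1), (6, 57, 11, 1),
    (9, 72, 5, 1), (12, 78, 23, 1), (15, 75, 14, 1), (18, 63, 8, 1), (21, 69, 26, 1),
    (24, 66, 17, 1), (29, 2, 1, 3), (32, 8, 19, 3), (35, 5, 10, 3), (38, 20, 4, 3),
    (41, 26, 22, 3), (44, 23, 13, 3), (47, 11, 7, 3), (50, 17, 25, 3), (53, 14, 16, 3),
    (0, 54, 28, 0), (3, 60, 46, 0), (6, 57, 37, 0), (9, 72, 31, 0), (12, 78, 49, 0),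
    (15, 75, 40, 0), (18, 63, 34, 0), (21, 69, 52, 0), (24, 66, 43, 0), (28, 82, 2, 2),
    (31, 88, 20, 2), (34, 85, 11, 2), (37, 100, 5, 2), (40, 106, 23, 2), (43, 103, 14, 2),
    (46, 91, 8, 2), (49, 97, 26, 2), (52, 94, 17, 2), (29, 83, 1, 2), (32, 89, 19, 2),
    (35, 86, 10, 2), (38, 101, 4, 2), (41, 107, 22, 2), (44, 104, 13, 2), (47, 92, 7, 2),
    (50, 98, 25, 2), (53, 95, 16, 2)])
    (by decide +kernel) (by decide +kernel) (by decide +kernel)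

lemma fourthRootFamily_rotation4 : FourthRootFamily (rotation (ZMod 4)) (2, 0) :=
  fourthRootFamily_of_exact (l := [
    (6, 6, 8, 0), (7, 25, 2, 3), (6, 6, 25, 1), (0, 24, 2, 1), (8, 2, 1, 3), (0, 24, 7, 0),
    (7, 31, 2, 2), (8, 32, 1, 2), (34, 16, 14, 0), (34, 16, 14, 1), (34, 16, 14, 2),
    (34, 16, 14, 3), (9, 42, 23, 0), (9, 42, 23, 1), (9, 42, 23, 2), (9, 42, 23, 3),
    (20, 5, 21, 0), (20, 5, 21, 1), (20, 5, 21, 2), (20, 5, 21, 3), (11, 41, 13, 0),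
    (11, 41, 13, 1), (11, 41, 13, 2), (11, 41, 13, 3), (12, 15, 28, 0), (12, 15, 28, 1),
    (12, 15, 28, 2), (12, 15, 28, 3), (22, 43, 3, 0), (22, 43, 3, 1), (22, 43, 3, 2),
    (22, 43, 3, 3)])
    (by decide +kernel) (by decide +kernel) (by decide +kernel)

lemma signFamily_rotation2_prod3 : SignFamily ((rotation (ZMod 2)).prod (ZMod 3)) ((1, 0), 0) :=
  signFamily_of_exact (l := [
    (0, 15, 16, 0, 0), (0, 9, 20, 1, 1), (7, 31, 21, 1, 1), (9, 21, 22, 1, 1), (12, 30, 20, 0, 0),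
    (7, 10, 26, 0, 0), (5, 35, 16, 1, 1), (6, 6, 23, 0, 0), (1, 19, 26, 1, 1), (14, 11, 15, 0, 0),
    (11, 14, 4, 0, 0), (13, 28, 17, 1, 1)])
    (by decide +kernel) (by decide +kernel) (by decide +kernel)

lemma signFamily_rotation2_prod9 : SignFamily ((rotation (ZMod 2)).prod (ZMod 3 × ZMod 3))
    ((1, 0), 0) :=
  signFamily_of_exact (l := [
    (28, 25, 65, 0, 1), (38, 53, 10, 1, 0), (16, 73, 33, 0, 1), (8, 2, 15, 1, 0),
    (23, 74, 30, 1, 1), (51, 99, 49, 1, 0), (32, 86, 9, 1, 0), (40, 100, 12, 0, 0),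
    (19, 34, 5, 0, 0), (4, 76, 23, 0, 0), (0, 18, 8, 0, 0), (29, 80, 61, 1, 1),
    (21, 27, 64, 1, 1), (37, 91, 95, 1, 1), (1, 13, 48, 1, 1), (36, 45, 34, 0, 0),
    (6, 60, 103, 1, 1), (39, 9, 83, 0, 0), (42, 72, 44, 1, 0), (14, 47, 82, 1, 1),
    (50, 68, 79, 1, 0), (52, 70, 71, 0, 1), (31, 94, 24, 0, 0), (1, 4, 53, 0, 1),
    (0, 84, 5, 1, 1), (48, 93, 61, 0, 0), (21, 78, 101, 0, 1), (31, 76, 44, 1, 1),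
    (2, 35, 57, 1, 0), (50, 89, 106, 0, 1), (20, 17, 69, 1, 1), (42, 3, 92, 0, 0),
    (11, 26, 27, 0, 1), (33, 12, 41, 0, 0), (43, 43, 105, 0, 0), (13, 46, 90, 1, 1)])
    (by decide +kernel) (by decide +kernel) (by decide +kernel)

lemma signFamily_rotation4 : SignFamily (rotation (ZMod 4)) (2, 0) :=
  signFamily_of_exact (l := [
    (23, 38, 6, 0, 0), (8, 20, 22, 0, 0), (2, 2, 36, 0, 0), (21, 3, 29, 0, 0), (16, 43, 23, 1, 1),
    (4, 40, 29, 1, 1), (13, 31, 11, 0, 0), (0, 3, 13, 1, 1), (18, 36, 44, 0, 0),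
    (9, 33, 19, 1, 1), (17, 41, 18, 1, 1), (22, 1, 21, 1, 1), (0, 15, 34, 0, 0), (1, 4, 11, 1, 1),
    (7, 10, 39, 0, 0), (8, 14, 6, 1, 1)])
    (by decide +kernel) (by decide +kernel) (by decide +kernel)

lemma splittable_two_three : Splittable ((ZMod 2 × ZMod 2) × ZMod 3) ((1, 0), 0) := by
  let k₀ : Fin 6 → Fin 3 → (ZMod 2 × ZMod 2) × ZMod 3 := ![
    ![((0, 0), 0), ((0, 0), 0), ((0, 0), 0)],
    ![((0, 1), 0), ((0, 1), 2), ((0, 1), 1)],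
    ![((0, 0), 1), ((0, 1), 1), ((1, 0), 1)],
    ![((0, 0), 2), ((0, 1), 0), ((1, 1), 2)],
    ![((0, 1), 2), ((0, 0), 1), ((1, 1), 0)],
    ![((0, 1), 1), ((1, 0), 2), ((0, 0), 2)]]
  let k₁ : Fin 6 → Fin 3 → (ZMod 2 × ZMod 2) × ZMod 3 := ![
    ![((0, 0), 0), ((0, 0), 1), ((0, 0), 2)],
    ![((0, 0), 2), ((1, 0), 2), ((1, 1), 0)],
    ![((0, 1), 1), ((1, 1), 2), ((0, 0), 0)],
    ![((0, 1), 2), ((1, 1), 1), ((1, 0), 1)],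
    ![((0, 1), 0), ((1, 0), 0), ((1, 1), 2)],
    ![((0, 0), 1), ((1, 1), 0), ((0, 1), 1)]]
  refine ⟨Fin 6, fun x => cond x.1 (k₁ x.2) (k₀ x.2), ?_, ?_⟩ <;> decide +kernel

lemma splittable_four : Splittable (ZMod 4 × ZMod 4) (2, 0) := by
  let k₀ : Fin 8 → Fin 3 → ZMod 4 × ZMod 4 := ![
    ![(0, 0), (0, 0), (0, 0)],
    ![(0, 1), (3, 3), (1, 0)],
    ![(1, 0), (0, 1), (3, 3)],
    ![(1, 1), (3, 0), (0, 3)],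
    ![(3, 3), (1, 1), (3, 1)],
    ![(3, 2), (2, 2), (2, 1)],
    ![(0, 2), (0, 3), (3, 2)],
    ![(0, 3), (3, 2), (0, 2)]]
  let k₁ : Fin 8 → Fin 3 → ZMod 4 × ZMod 4 := ![
    ![(0, 2), (2, 2), (2, 0)],
    ![(0, 3), (1, 1), (3, 0)],
    ![(1, 2), (2, 3), (1, 3)],
    ![(1, 3), (1, 2), (2, 3)],
    ![(3, 0), (0, 0), (0, 1)],
    ![(3, 1), (3, 3), (1, 1)],
    ![(0, 1), (1, 0), (2, 2)],
    ![(0, 0), (2, 1), (1, 2)]]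
  refine ⟨Fin 8, fun x => cond x.1 (k₁ x.2) (k₀ x.2), ?_, ?_⟩ <;> decide +kernel

end Twist

/-! ### Cyclic groups of even order -/

/-- The embedding of `ℤ/n` into `ℤ/kn` that sends `1` to `k`. -/
lemma exists_zmod_embedding (k n : ℕ) (hk : k ≠ 0) : ∃ φ : ZMod n →+ ZMod (k * n),
    Function.Injective φ ∧ ∀ z : ℤ, φ z = ((k * z : ℤ) : ZMod (k * n)) := by
  let f : ℤ →+ ZMod (k * n) :=
    (Int.castAddHom (ZMod (k * n))).comp (AddMonoidHom.mulLeft (k : ℤ))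
  have hf : f n = 0 := by
    have : f n = ((k * n : ℕ) : ZMod (k * n)) := by
      show (((k : ℤ) * (n : ℤ) : ℤ) : ZMod (k * n)) = _
      push_cast
      rfl
    rw [this, ZMod.natCast_self]
  have h : ∀ z : ℤ, ZMod.lift n ⟨f, hf⟩ z = ((k * z : ℤ) : ZMod (k * n)) := fun z =>
    ZMod.lift_coe n ⟨f, hf⟩ z
  refine ⟨ZMod.lift n ⟨f, hf⟩, (injective_iff_map_eq_zero _).2 fun a ha => ?_, h⟩
  obtain ⟨z, rfl⟩ := ZMod.intCast_surjective a
  rw [h, ZMod.intCast_zmod_eq_zero_iff_dvd, Nat.cast_mul] at ha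
  rw [ZMod.intCast_zmod_eq_zero_iff_dvd]
  exact Int.dvd_of_mul_dvd_mul_left (by exact_mod_cast hk) ha

lemma even_intCast_zmod {n : ℕ} (hn : Even n) (z : ℤ) : Even (z : ZMod n) ↔ Even z := by
  constructor
  · rintro ⟨r, hr⟩
    obtain ⟨y, rfl⟩ := ZMod.intCast_surjective r
    rw [← Int.cast_add, ZMod.intCast_eq_intCast_iff_dvd_sub] at hr
    have h2 : (2 : ℤ) ∣ n := by exact_mod_cast hn.two_dvd
    obtain ⟨c, hc⟩ := h2.trans hr
    exact ⟨y - c, by omega⟩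
  · rintro ⟨y, rfl⟩
    exact ⟨y, by push_cast; rfl⟩

lemma even_castHom_zmod {k n : ℕ} (hk : Even k) (h : k ∣ n) (a : ZMod n) :
    Even (ZMod.castHom h (ZMod k) a) ↔ Even a := by
  obtain ⟨z, rfl⟩ := ZMod.intCast_surjective a
  rw [map_intCast, even_intCast_zmod hk, even_intCast_zmod (hk.trans_dvd h)]

namespace Twist

/-! ### Covers over the groups of order `4 ^ m` -/

/-- The factor `W` of a complete cover is kept while the factor `A` is enlarged to `A'`. -/
lemma Complete.prod_of_relCover {A A' W : Type} [AddCommGroup A] [AddCommGroup A'] [CommRing W]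
    {T : Twist A} {T' : Twist A'} {j : A} {j' : A'} (h : (T.prod W).Complete (j, 0))
    (hW : Homogeneous W) (φ : A →+ A') (hφ : Function.Injective φ)
    (hT : ∀ c a, φ (T.act c a) = T'.act c (φ a)) (hj : φ j = j')
    (h' : T'.RelCover j' (Set.range φ)) : (T'.prod W).Complete (j', 0) := by
  refine h.of_relCover (φ.prodMap (AddMonoidHom.id W)) (hφ.prodMap Function.injective_id)
    (fun c a => Prod.ext (hT c a.1) rfl) (Prod.ext hj rfl) ?_
  have : Set.range (φ.prodMap (AddMonoidHom.id W)) = {x | x.1 ∈ Set.range φ} := by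
    ext ⟨a, w⟩
    constructor
    · rintro ⟨x, hx⟩
      exact ⟨x.1, congrArg Prod.fst hx⟩
    · rintro ⟨x, hx⟩
      exact ⟨(x, w), Prod.ext hx rfl⟩
  rw [this]
  exact RelCover.prod hW h'

/-- The involution `(n / 2, 0)` of `(ℤ/n)²` for even `n`. -/
def halfPoint (n : ℕ) : ZMod n × ZMod n := ((n / 2 : ℕ), 0)

/-- The subgroup of the doubles of elements of `(ℤ/n)²`. -/
def evens (n : ℕ) : Set (ZMod n × ZMod n) := {x | Even x.1 ∧ Even x.2}

lemma rotation_map {M M' : Type} [AddCommGroup M] [AddCommGroup M'] (φ : M →+ M') (c : ZMod 3)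
    (a : M × M) : φ.prodMap φ ((rotation M).act c a) = (rotation M').act c (φ.prodMap φ a) := by
  have hc : ∀ c : ZMod 3, c = 0 ∨ c = 1 ∨ c = 2 := by decide
  rcases hc c with rfl | rfl | rfl
  · rfl
  · exact Prod.ext (map_neg φ _) (map_sub φ _ _)
  · exact Prod.ext (map_sub φ _ _) (map_neg φ _)

/-- The subgroup `2 (ℤ/2n)²` is a copy of `(ℤ/n)²`. -/
lemma exists_double {n : ℕ} (hn : Even n) : ∃ φ : ZMod n × ZMod n →+ ZMod (2 * n) × ZMod (2 * n),
    Function.Injective φ ∧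
    (∀ c a, φ ((rotation (ZMod n)).act c a) = (rotation (ZMod (2 * n))).act c (φ a)) ∧
    φ (halfPoint n) = halfPoint (2 * n) ∧ Set.range φ = evens (2 * n) := by
  obtain ⟨φ, hφ, hz⟩ := exists_zmod_embedding 2 n two_ne_zero
  have hr : ∀ a, Even a ↔ ∃ b, φ b = a := by
    intro a
    constructor
    · rintro ⟨r, rfl⟩
      obtain ⟨z, rfl⟩ := ZMod.intCast_surjective r
      exact ⟨z, by rw [hz]; push_cast; ring⟩
    · rintro ⟨b, rfl⟩
      obtain ⟨z, rfl⟩ := ZMod.intCast_surjective b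
      exact ⟨z, by rw [hz]; push_cast; ring⟩
  refine ⟨φ.prodMap φ, hφ.prodMap hφ, rotation_map φ, Prod.ext ?_ (map_zero φ), ?_⟩
  · have h := hz ((n / 2 : ℕ) : ℤ)
    rw [Int.cast_natCast] at h
    refine h.trans ?_
    have : ((2 : ℕ) * ((n / 2 : ℕ) : ℤ)) = ((2 * n / 2 : ℕ) : ℤ) := by
      obtain ⟨k, rfl⟩ := hn
      omega
    rw [this, Int.cast_natCast]
    rfl
  · ext ⟨a, b⟩
    constructor
    · rintro ⟨x, hx⟩
      exact ⟨(hr a).2 ⟨x.1, congrArg Prod.fst hx⟩, (hr b).2 ⟨x.2, congrArg Prod.snd hx⟩⟩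
    · rintro ⟨ha, hb⟩
      obtain ⟨x, hx⟩ := (hr a).1 ha
      obtain ⟨y, hy⟩ := (hr b).1 hb
      exact ⟨(x, y), Prod.ext hx hy⟩

/-- Reduction `(ℤ/nk)² → (ℤ/n)²` has kernel `(ℤ/k)²`. -/
lemma exists_reduction {n k : ℕ} (hn : Even n) (hn0 : n ≠ 0) (hk : Even k) :
    ∃ (κ : ZMod k × ZMod k →+ ZMod (n * k) × ZMod (n * k))
      (π : ZMod (n * k) × ZMod (n * k) →+ ZMod n × ZMod n),
      Function.Injective κ ∧ κ (halfPoint k) = halfPoint (n * k) ∧ Function.Surjective π ∧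
      (∀ a, π a = 0 → ∃ m, κ m = a) ∧ (∀ m, π (κ m) = 0) ∧
      (∀ c a, π ((rotation (ZMod (n * k))).act c a) = (rotation (ZMod n)).act c (π a)) ∧
      {a | π a ∈ evens n} = evens (n * k) := by
  obtain ⟨φ, hφ, hz⟩ := exists_zmod_embedding n k hn0
  let ρ : ZMod (n * k) →+ ZMod n := ZMod.castHom (dvd_mul_right n k) (ZMod n)
  have hρ : ∀ z : ℤ, ρ z = z := fun z => map_intCast (ZMod.castHom (dvd_mul_right n k) (ZMod n)) z
  have h1 : ∀ a, ρ a = 0 → ∃ m, φ m = a := by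
    intro a ha
    obtain ⟨z, rfl⟩ := ZMod.intCast_surjective a
    rw [hρ, ZMod.intCast_zmod_eq_zero_iff_dvd] at ha
    obtain ⟨y, rfl⟩ := ha
    exact ⟨y, hz y⟩
  have h2 : ∀ m, ρ (φ m) = 0 := by
    intro m
    obtain ⟨z, rfl⟩ := ZMod.intCast_surjective m
    rw [hz, hρ, ZMod.intCast_zmod_eq_zero_iff_dvd]
    exact dvd_mul_right _ _
  have h3 : Function.Surjective ρ := ZMod.castHom_surjective (dvd_mul_right n k)
  refine ⟨φ.prodMap φ, ρ.prodMap ρ, hφ.prodMap hφ, Prod.ext ?_ (map_zero φ), h3.prodMap h3, ?_,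
    fun m => Prod.ext (h2 m.1) (h2 m.2), rotation_map ρ, ?_⟩
  · have h := hz ((k / 2 : ℕ) : ℤ)
    rw [Int.cast_natCast] at h
    refine h.trans ?_
    have : (n : ℤ) * ((k / 2 : ℕ) : ℤ) = ((n * k / 2 : ℕ) : ℤ) := by
      rw [Nat.mul_div_assoc n hk.two_dvd, Nat.cast_mul]
    rw [this, Int.cast_natCast]
    rfl
  · rintro ⟨a, b⟩ h
    obtain ⟨x, hx⟩ := h1 a (congrArg Prod.fst h)
    obtain ⟨y, hy⟩ := h1 b (congrArg Prod.snd h)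
    exact ⟨(x, y), Prod.ext hx hy⟩
  · ext ⟨a, b⟩
    exact and_congr (even_castHom_zmod hn (dvd_mul_right n k) a)
      (even_castHom_zmod hn (dvd_mul_right n k) b)

/-- The kernel of the reduction `(ℤ/4n)² → (ℤ/n)²` carries the difference matrix over `(ℤ/4)²`. -/
lemma relCover_rotation_mul_four {n : ℕ} (hn : Even n) (hn0 : n ≠ 0)
    (h : (rotation (ZMod n)).RelCover (halfPoint n) (evens n)) :
    (rotation (ZMod (n * 4))).RelCover (halfPoint (n * 4)) (evens (n * 4)) := by
  obtain ⟨κ, π, h1, h2, h3, h4, h5, h6, h7⟩ := exists_reduction hn hn0 (k := 4) (by decide)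
  rw [← h7]
  exact h.lift splittable_four κ h1 h2 π h3 h4 h5 h6

/-- The kernel of `(ℤ/2n)² × ℤ/3 → (ℤ/n)²` carries the difference matrix over `(ℤ/2)² × ℤ/3`. -/
lemma relCover_rotation_prod_three {n : ℕ} (hn : Even n) (hn0 : n ≠ 0)
    (h : (rotation (ZMod n)).RelCover (halfPoint n) (evens n)) :
    ((rotation (ZMod (n * 2))).prod (ZMod 3)).RelCover (halfPoint (n * 2), 0)
      {x | x.1 ∈ evens (n * 2)} := by
  obtain ⟨κ, π, h1, h2, h3, h4, h5, h6, h7⟩ := exists_reduction hn hn0 (k := 2) (by decide)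
  rw [← h7]
  have hj : κ (1, 0) = halfPoint (n * 2) := h2
  refine h.lift (T := (rotation (ZMod (n * 2))).prod (ZMod 3)) (j := (halfPoint (n * 2), 0))
    splittable_two_three (κ.prodMap (AddMonoidHom.id (ZMod 3)))
    (h1.prodMap Function.injective_id) (Prod.ext hj rfl)
    (π.comp (AddMonoidHom.fst _ _)) (h3.comp Prod.fst_surjective) ?_ (fun m => h5 m.1)
    fun c a => h6 c a.1
  rintro ⟨a, x⟩ ha
  obtain ⟨m, hm⟩ := h4 a ha
  exact ⟨(m, x), Prod.ext hm rfl⟩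

lemma even_two_pow_succ (m : ℕ) : Even (2 ^ (m + 1)) := (even_two).pow_of_ne_zero (by omega)

lemma relCover_rotation_two_pow (m : ℕ) : (rotation (ZMod (2 ^ (m + 2)))).RelCover
    (halfPoint (2 ^ (m + 2))) (evens (2 ^ (m + 2))) := by
  induction m using Nat.twoStepInduction with
  | zero => exact relCover_rotation4
  | one => exact relCover_rotation8
  | more m h _ =>
    rw [show 2 ^ (m + 2 + 2) = 2 ^ (m + 2) * 4 from pow_add 2 (m + 2) 2]
    exact relCover_rotation_mul_four (even_two_pow_succ _) (by positivity) h

lemma relCover_rotation_two_pow_prod_three (m : ℕ) :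
    ((rotation (ZMod (2 ^ (m + 2)))).prod (ZMod 3)).RelCover
      (halfPoint (2 ^ (m + 2)), 0) {x | x.1 ∈ evens (2 ^ (m + 2))} := by
  cases m with
  | zero => exact relCover_rotation4_prod3
  | succ m =>
    rw [show 2 ^ (m + 1 + 2) = 2 ^ (m + 2) * 2 from pow_succ 2 (m + 2)]
    exact relCover_rotation_prod_three (even_two_pow_succ _) (by positivity)
      (relCover_rotation_two_pow m)

lemma complete_rotation_two_pow {W : Type} [CommRing W] (hW : Homogeneous W)
    (h : (rotation (ZMod 4)).RelProd (2, 0) W) (m : ℕ) :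
    ((rotation (ZMod (2 ^ (m + 2)))).prod W).Complete (halfPoint (2 ^ (m + 2)), 0) := by
  induction m with
  | zero => exact complete_rotation4.prod h
  | succ m ih =>
    obtain ⟨φ, h1, h2, h3, h4⟩ := exists_double (even_two_pow_succ (m + 1))
    rw [pow_succ' 2 (m + 2)]
    refine ih.prod_of_relCover hW φ h1 h2 h3 ?_
    rw [h4, ← pow_succ']
    exact relCover_rotation_two_pow (m + 1)

lemma complete_rotation_two_pow_prod_three {W : Type} [CommRing W] (hW : Homogeneous W)
    (h : ((rotation (ZMod 2)).prod (ZMod 3)).RelProd ((1, 0), 0) W) (m : ℕ) :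
    (((rotation (ZMod (2 ^ (m + 1)))).prod (ZMod 3)).prod W).Complete
      ((halfPoint (2 ^ (m + 1)), 0), 0) := by
  induction m with
  | zero => exact complete_rotation2_prod3.prod h
  | succ m ih =>
    obtain ⟨φ, h1, h2, h3, h4⟩ := exists_double (even_two_pow_succ m)
    rw [pow_succ' 2 (m + 1)]
    refine ih.prod_of_relCover hW (φ.prodMap (AddMonoidHom.id (ZMod 3)))
      (h1.prodMap Function.injective_id) (fun c a => Prod.ext (h2 c a.1) rfl)
      (Prod.ext h3 rfl) ?_
    have : Set.range (φ.prodMap (AddMonoidHom.id (ZMod 3))) =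
        {x | x.1 ∈ evens (2 * 2 ^ (m + 1))} := by
      rw [← h4]
      ext ⟨a, w⟩
      constructor
      · rintro ⟨x, hx⟩
        exact ⟨x.1, congrArg Prod.fst hx⟩
      · rintro ⟨x, hx⟩
        exact ⟨(x, w), Prod.ext hx rfl⟩
    rw [this, ← pow_succ']
    exact relCover_rotation_two_pow_prod_three m

end Twist

namespace Twist

/-! ### Rings of odd order -/

lemma homogeneous_of_field {F : Type} [Field F] [Fintype F] (h2 : (2 : F) ≠ 0)
    (hcard : 3 < Fintype.card F) : Homogeneous F := by
  obtain ⟨x, x0, x1, x2⟩ := exists_ne_zero_one_neg_one hcard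
  have hx1 : x - 1 ≠ 0 := sub_ne_zero.2 x1
  have hx1' : 1 - x ≠ 0 := sub_ne_zero.2 (Ne.symm x1)
  have hx2 : x + 1 ≠ 0 := fun h => x2 (eq_neg_of_add_eq_zero_left h)
  have hx2' : -1 - x ≠ 0 := fun h => x2 (by linear_combination -h)
  have h2' : (1 : F) + 1 ≠ 0 := by rwa [one_add_one_eq_two]
  have h2'' : (-1 : F) - 1 ≠ 0 := fun h => h2 (by linear_combination -h)
  refine ⟨![1, -1, x], fun a => ?_, fun a b hab => ?_⟩
  · fin_cases a <;> simp [x0]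
  · fin_cases a <;> fin_cases b <;> first | exact absurd rfl hab | simp [*]

/-- Every odd `w` that is not divisible exactly once by `3` is the order of a product `W` of fields
with at least five elements each. -/
lemma exists_ring (w : ℕ) (hw : Odd w) (h3 : 3 ∣ w → 9 ∣ w) :
    ∃ (W : Type) (_ : CommRing W), Finite W ∧ Nat.card W = w ∧ Homogeneous W ∧
      ∀ {A : Type} [AddCommGroup A] {T : Twist A} {j : A}, T.FourthRootFamily j →
        T.SignFamily j → T.RelProd j W := by
  induction w using Nat.recOnPosPrimePosCoprime with
  | zero => exact absurd hw (by decide)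
  | one =>
    exact ⟨PUnit, inferInstance, inferInstance, by simp,
      ⟨1, fun _ => isUnit_of_subsingleton _, fun _ _ _ => isUnit_of_subsingleton _⟩,
      fun _ _ => relProd_of_subsingleton _⟩
  | prime_pow p n hp hn =>
    have := Fact.mk hp
    have := Fintype.ofFinite (GaloisField p n)
    have hcard : Fintype.card (GaloisField p n) = p ^ n := by
      rw [Fintype.card_eq_nat_card, GaloisField.card p n hn.ne']
    have hodd : Fintype.card (GaloisField p n) % 2 = 1 := by rw [hcard]; exact Nat.odd_iff.1 hw
    have hlarge : 3 < Fintype.card (GaloisField p n) := by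
      rw [hcard]
      by_contra! hle
      have hpos : 1 < p ^ n := Nat.one_lt_pow hn.ne' hp.one_lt
      -- the order is odd and greater than one, and `3` is excluded by the hypothesis on `w`
      have : p ^ n = 3 := by
        rw [hcard] at hodd
        omega
      rw [this] at h3
      exact absurd (h3 dvd_rfl) (by decide)
    have h2 : (2 : GaloisField p n) ≠ 0 := Ring.two_ne_zero (by
      intro h
      rw [FiniteField.even_card_iff_char_two.1 h] at hodd
      omega)
    refine ⟨GaloisField p n, inferInstance, inferInstance,
      by rw [← Fintype.card_eq_nat_card, hcard], homogeneous_of_field h2 hlarge, fun hI hJ => ?_⟩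
    by_cases h : Fintype.card (GaloisField p n) % 4 = 3
    · exact hJ.relProd h hlarge
    · obtain ⟨r, hr⟩ := FiniteField.isSquare_neg_one_iff.2 h
      exact hI.relProd h2 (r := r) (by rw [hr, sq])
  | coprime a b ha hb hab iha ihb =>
    obtain ⟨oa, ob⟩ := Nat.odd_mul.1 hw
    have key : ∀ {a b : ℕ}, a.Coprime b → (3 ∣ a * b → 9 ∣ a * b) → 3 ∣ a → 9 ∣ a := by
      intro a b hab h h3
      have hb : Nat.Coprime (3 ^ 2) b := (hab.coprime_dvd_left h3).pow_left 2
      exact hb.dvd_of_dvd_mul_right (h (h3.mul_right b))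
    obtain ⟨W, _, _, hc, hW, hP⟩ := iha oa (key hab h3)
    obtain ⟨W', _, _, hc', hW', hP'⟩ := ihb ob (key hab.symm (by rwa [mul_comm]))
    exact ⟨W × W', inferInstance, inferInstance, by rw [Nat.card_prod, hc, hc'], hW.prod hW',
      fun hI hJ => RelProd.prod hW' (hP hI hJ) (hP' hI hJ)⟩

/-! ### Existence of the systems -/

lemma halfPoint_spec {n : ℕ} (hn : Even n) (hn0 : n ≠ 0) :
    halfPoint n + halfPoint n = 0 ∧ halfPoint n ≠ 0 ∧
      (rotation (ZMod n)).act 1 (halfPoint n) ≠ halfPoint n := by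
  obtain ⟨k, rfl⟩ := hn
  have hk : (k + k) / 2 = k := by omega
  have h0 : ((k : ℕ) : ZMod (k + k)) ≠ 0 := by
    rw [Ne, ZMod.natCast_eq_zero_iff]
    intro h
    have := Nat.le_of_dvd (by omega) h
    omega
  refine ⟨Prod.ext ?_ (add_zero 0), fun h => h0 ?_, fun h => h0 ?_⟩
  · show (((k + k) / 2 : ℕ) : ZMod (k + k)) + (((k + k) / 2 : ℕ) : ZMod (k + k)) = 0
    rw [hk, ← Nat.cast_add, ZMod.natCast_self]
  · have : (((k + k) / 2 : ℕ) : ZMod (k + k)) = 0 := congrArg Prod.fst h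
    rwa [hk] at this
  · have : (((k + k) / 2 : ℕ) : ZMod (k + k)) - 0 = 0 := congrArg Prod.snd h
    rwa [hk, sub_zero] at this

/-- Complete covers over groups that contain `(ℤ/n)²`, with `j` its involution `(n / 2, 0)`. -/
lemma exists_kirkman_of_rotation {n v : ℕ} (hn : Even n) (hn0 : n ≠ 0) {A : Type}
    [AddCommGroup A] [Finite A] {T : Twist A} {j : A} (i : ZMod n × ZMod n →+ A)
    (hi : Function.Injective i) (hT : ∀ c a, i ((rotation (ZMod n)).act c a) = T.act c (i a))
    (hj : i (halfPoint n) = j) (h : T.Complete j) (hv : v = 3 * Nat.card A + 3) :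
    ∃ (V : Type) (_ : Fintype V), Fintype.card V = v ∧
      ∃ K : KirkmanTripleSystem V, K.IsPyramidal 3 ∧ v - 3 ≤ Nat.card K.autGroup := by
  obtain ⟨h1, h2, h3⟩ := halfPoint_spec hn hn0
  obtain ⟨V, _, hV, K, hK, hK'⟩ := h.exists_kirkman
    (by rw [← hj, ← map_add, h1, map_zero])
    (by rw [← hj]; exact fun h => h2 ((map_eq_zero_iff i hi).1 h))
    (by rw [← hj, ← hT]; exact fun h => h3 (hi h))
  rw [hV, ← hv] at hK'
  exact ⟨V, _, hV.trans hv.symm, K, hK, hK'⟩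

lemma exists_kirkman_thirty_six_mul (w : ℕ) (hw : Odd w) :
    ∃ (V : Type) (_ : Fintype V), Fintype.card V = 36 * w + 3 ∧
      ∃ K : KirkmanTripleSystem V, K.IsPyramidal 3 ∧ 36 * w + 3 - 3 ≤ Nat.card K.autGroup := by
  by_cases h3 : 3 ∣ w → 9 ∣ w
  · obtain ⟨W, _, _, hc, hW, hP⟩ := exists_ring w hw h3
    refine exists_kirkman_of_rotation (n := 2) even_two two_ne_zero
      ((AddMonoidHom.inl _ W).comp (AddMonoidHom.inl _ (ZMod 3)))
      (fun a b h => congrArg (fun x => x.1.1) h) (fun _ _ => rfl) rfl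
      (complete_rotation2_prod3.prod
        (hP fourthRootFamily_rotation2_prod3 signFamily_rotation2_prod3)) ?_
    simp only [Nat.card_prod, Nat.card_zmod, hc]
    ring
  · -- the only prime power factor that is not the order of a suitable field is `3`: the base
    -- group has a further factor `ℤ/3` in its place
    push Not at h3
    obtain ⟨⟨w, rfl⟩, h9⟩ := h3
    obtain ⟨W, _, _, hc, hW, hP⟩ := exists_ring w (Nat.odd_mul.1 hw).2
      fun h => absurd (mul_dvd_mul_left 3 h) h9
    refine exists_kirkman_of_rotation (n := 2) even_two two_ne_zero
      ((AddMonoidHom.inl _ W).comp (AddMonoidHom.inl _ (ZMod 3 × ZMod 3)))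
      (fun a b h => congrArg (fun x => x.1.1) h) (fun _ _ => rfl) rfl
      (complete_rotation2_prod9.prod
        (hP fourthRootFamily_rotation2_prod9 signFamily_rotation2_prod9)) ?_
    simp only [Nat.card_prod, Nat.card_zmod, hc]
    ring

lemma exists_kirkman_four_pow_mul (e w : ℕ) (hw : Odd w) :
    ∃ (V : Type) (_ : Fintype V), Fintype.card V = 4 ^ e * 48 * w + 3 ∧
      ∃ K : KirkmanTripleSystem V, K.IsPyramidal 3 ∧
        4 ^ e * 48 * w + 3 - 3 ≤ Nat.card K.autGroup := by
  have h4 : (4 : ℕ) ^ e = 2 ^ e * 2 ^ e := by rw [← mul_pow]; norm_num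
  by_cases h3 : 3 ∣ w → 9 ∣ w
  · obtain ⟨W, _, _, hc, hW, hP⟩ := exists_ring w hw h3
    refine exists_kirkman_of_rotation (even_two_pow_succ (e + 1)) (by positivity)
      (AddMonoidHom.inl _ W) (fun a b h => congrArg Prod.fst h) (fun _ _ => rfl) rfl
      (complete_rotation_two_pow hW (hP fourthRootFamily_rotation4 signFamily_rotation4) e) ?_
    simp only [Nat.card_prod, Nat.card_zmod, hc, h4]
    ring
  · -- the base group takes over the factor `3`
    push Not at h3
    obtain ⟨⟨w, rfl⟩, h9⟩ := h3
    obtain ⟨W, _, _, hc, hW, hP⟩ := exists_ring w (Nat.odd_mul.1 hw).2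
      fun h => absurd (mul_dvd_mul_left 3 h) h9
    refine exists_kirkman_of_rotation (even_two_pow_succ (e + 1)) (by positivity)
      ((AddMonoidHom.inl _ W).comp (AddMonoidHom.inl _ (ZMod 3)))
      (fun a b h => congrArg (fun x => x.1.1) h) (fun _ _ => rfl) rfl
      (complete_rotation_two_pow_prod_three hW
        (hP fourthRootFamily_rotation2_prod3 signFamily_rotation2_prod3) (e + 1)) ?_
    simp only [Nat.card_prod, Nat.card_zmod, hc, h4]
    ring

end Twist

theorem mainTheorem2 :
    (∀ v : ℕ, v ≡ 39 [MOD 72] →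
      ∃ (V : Type) (_ : Fintype V), Fintype.card V = v ∧
        ∃ K : KirkmanTripleSystem V, K.IsPyramidal 3 ∧ v - 3 ≤ Nat.card K.autGroup) ∧
    (∀ e v : ℕ, v ≡ 4 ^ e * 48 + 3 [MOD 4 ^ e * 96] →
      ∃ (V : Type) (_ : Fintype V), Fintype.card V = v ∧
        ∃ K : KirkmanTripleSystem V, K.IsPyramidal 3 ∧ v - 3 ≤ Nat.card K.autGroup) := by
  constructor
  · intro v hv
    have hv' : v % 72 = 39 := hv
    obtain ⟨k, rfl⟩ : ∃ k, v = 36 * (2 * k + 1) + 3 := ⟨v / 72, by omega⟩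
    exact Twist.exists_kirkman_thirty_six_mul _ (odd_two_mul_add_one k)
  · intro e v hv
    have hpos : 0 < 4 ^ e := by positivity
    have hv' : v % (4 ^ e * 96) = 4 ^ e * 48 + 3 := by
      rw [hv, Nat.mod_eq_of_lt (by omega)]
    obtain ⟨k, rfl⟩ : ∃ k, v = 4 ^ e * 48 * (2 * k + 1) + 3 :=
      ⟨v / (4 ^ e * 96), by
        have := Nat.div_add_mod v (4 ^ e * 96)
        rw [hv'] at this
        linarith⟩
    exact Twist.exists_kirkman_four_pow_mul e _ (odd_two_mul_add_one k)
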